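/- Let $\mathscr R$ be a commutative ring with $1\neq 0$, let $U$ be a set with $n=2h$ elements, partitioned into $U_1$ and $U_2$ of size $h$, and let $f_i:2^U\to\mathscr R$ for $i\in U$. The multi-subset transform of $(f_i)_{i\in U}$ is $g(T)=\sum_{S\subseteq T}\prod_{i\in T}f_i(S)$, $T\subseteq U$. An operation is an addition or a multiplication in $\mathscr R$. For $k\ge 0$ let $\omega(k)$ be the smallest value such that, for every $\epsilon>0$, an $N\times\lceil N^k\rceil$ matrix can be multiplied by an $\lceil N^k\rceil\times N$ matrix over $\mathscr R$ with $O(N^{\omega(k)+\epsilon})$ operations (by straight-line programs over $\mathscr R$, which may use constants of $\mathscr R$ freely). Let $H(x)=-x\log_2x-(1-x)\log_2(1-x)$ and, for $0\le\sigma_p\le\kappa_p\le1$, $p=1,2$, $$\alpha_p=\kappa_pH\Big(\frac{\sigma_p}{\kappa_p}\Big),\qquad \beta_p=1-\kappa_p+\kappa_pH\Big(\max\Big\{\frac{\sigma_p}{\kappa_p},\frac12\Big\}\Big),\qquad \beta_*=\min\{\beta_1,\beta_2\},$$ $$\Gamma(\sigma_1,\sigma_2,\kappa_1,\kappa_2)=H(\sigma_1)+H(\sigma_2)-\alpha_1-\alpha_2+\beta_1+\beta_2+\beta_*\Big(\omega\Big(\frac{\alpha_1+\alpha_2}{\beta_*}\Big)-2\Big),$$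 where $0/0=0$ in $\sigma_p/\kappa_p$, and where the last term is read as its limit $\alpha_1+\alpha_2$ if $\beta_*=0$. Algorithm Cover-Columns. For $p=1,2$ let $F_p$ be the matrix with rows $T_p\subseteq U_p$ and columns $S\subseteq U$ and with the entries $F_p(T_p,S)=[S\cap U_p\subseteq T_p]\prod_{i\in T_p}f_i(S)$; the algorithm computes the entries with $S\cap U_p\subseteq T_p$. It sets $G(T)=0$ for all $T\subseteq U$ and $\mathscr C=\emptyset$. For every $(s_1,s_2)\in\{0,\dots,h\}^2$ it selects integers $k_p$ with $s_p\le k_p\le h$ that minimise $\Gamma(s_1/h,s_2/h,k_1/h,k_2/h)$ (with $0/0=0$ if $h=0$), and it finds by the greedy set cover algorithm, with ties broken arbitrarily, a family $\mathscr K_p$ of $k_p$-subsets of $U_p$ such that every $s_p$-subset of $U_p$ is contained in a member of $\mathscr K_p$. For every $(K_1,K_2)\in\mathscr K_1\times\mathscr K_2$ it lets $\mathscr S=\{S_1\cup S_2: S_p\subseteq K_p,\ |S_p|=s_p\ (p=1,2)\}$ and $\mathscr T_p=\{T_p\subseteq U_p:|T_p\cap K_p|\ge s_p\}$; it computes $E_1E_2^\top$,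 where $E_p$ is the submatrix of $F_p$ with rows $\mathscr T_p$ and columns $\mathscr S\setminus\mathscr C$, by a straight-line program with the least possible number of operations; it adds $(E_1E_2^\top)(T_1,T_2)$ to $G(T_1\cup T_2)$ for all $T_p\in\mathscr T_p$; and it replaces $\mathscr C$ by $\mathscr C\cup\mathscr S$. It returns $G$. Proposition. The max-min $$\gamma=\max_{\substack{0\le\sigma_1\le1\\0\le\sigma_2\le1}}\ \min_{\substack{\sigma_1\le\kappa_1\le1\\\sigma_2\le\kappa_2\le1}}\Gamma(\sigma_1,\sigma_2,\kappa_1,\kappa_2)$$ exists (the minima and the maximum are attained), and for every $\epsilon>0$ there is a constant $C$ such that for every even $n$, every $U=U_1\cup U_2$ as above and all $(f_i)_{i\in U}$, Cover-Columns can be carried out (choices as described exist), and, however it makes them, it returns the multi-subset transform of $(f_i)_{i\in U}$ using at most $C\,2^{(\gamma+\epsilon)n/2}$ operations. -/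

import Mathlib

universe u v w

namespace CoverColumns

open Filter Asymptotics

/-! ### Straight-line programs over a ring and the exponent of rectangular matrix multiplication -/

/-- An operand of an arithmetic operation: a constant of the ring, an input variable,
or the result of the `j`-th operation (counted from `0`). -/
inductive Operand (R : Type v) (ι : Type w) : Type (max v w)
  | const (c : R) : Operand R ι
  | input (i : ι) : Operand R ι
  | reg (j : ℕ) : Operand R ι

/-- The two arithmetic operations of the ring. -/
inductive Instr (R : Type v) (ι : Type w) : Type (max v w)
  | add (x y : Operand R ι) : Instr R ι
  | mul (x y : Operand R ι) : Instr R ι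

/-- A straight-line program over `R` with inputs indexed by `ι` and outputs indexed by `o`. -/
structure SLP (R : Type v) (ι : Type w) (o : Type u) where
  code : List (Instr R ι)
  out : o → Operand R ι

/-- The value of an operand, given the inputs `x` and the list of the results so far
(a result that has not been computed reads as `0`). -/
def Operand.eval {R : Type v} [CommRing R] {ι : Type w} (x : ι → R) (regs : List R) :
    Operand R ι → R
  | .const c => c
  | .input i => x i
  | .reg j => regs.getD j 0

def Instr.eval {R : Type v} [CommRing R] {ι : Type w} (x : ι → R) (regs : List R) :
    Instr R ι → R
  | .add y z => y.eval x regs + z.eval x regs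
  | .mul y z => y.eval x regs * z.eval x regs

namespace SLP

variable {R : Type v} [CommRing R] {ι : Type w} {o : Type u}

/-- The results of all operations of the program on the inputs `x`, in order. -/
def regs (P : SLP R ι o) (x : ι → R) : List R :=
  P.code.foldl (fun rs ins => rs ++ [ins.eval x rs]) []

/-- The outputs of the program on the inputs `x`. -/
def eval (P : SLP R ι o) (x : ι → R) (j : o) : R :=
  (P.out j).eval x (P.regs x)

/-- The number of arithmetic operations (additions and multiplications in `R`). -/
def size (P : SLP R ι o) : ℕ := P.code.length

end SLP

/-- Programs that take the entries of an `α × γ` matrix and of a `γ × β` matrix and return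
the entries of an `α × β` matrix. -/
abbrev MatProgram (R : Type v) (α β γ : Type w) : Type (max v w) :=
  SLP R ((α × γ) ⊕ (γ × β)) (α × β)

/-- The program computes the matrix product, for all matrices over `R`. -/
def MatProgram.Correct {R : Type v} [CommRing R] {α β γ : Type w} [Fintype γ]
    (P : MatProgram R α β γ) : Prop :=
  ∀ (A : Matrix α γ R) (B : Matrix γ β R) (i : α) (j : β),
    SLP.eval P (Sum.elim (fun p => A p.1 p.2) (fun p => B p.1 p.2)) (i, j) = (A * B) i j

/-- The program computes the matrix product with the least possible number of operations. -/
def MatProgram.Optimal {R : Type v} [CommRing R] {α β γ : Type w} [Fintype γ]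
    (P : MatProgram R α β γ) : Prop :=
  P.Correct ∧ ∀ Q : MatProgram R α β γ, Q.Correct → SLP.size P ≤ SLP.size Q

/-- The least number of arithmetic operations that suffices for multiplying an `a × c` matrix
by a `c × b` matrix over `R`. -/
noncomputable def mulCost (R : Type v) [CommRing R] (a c b : ℕ) : ℕ :=
  sInf {m | ∃ P : MatProgram R (Fin a) (Fin b) (Fin c), P.Correct ∧ SLP.size P = m}

/-- The exponent `ω(k)`: the smallest `w` such that, for every `ε > 0`, the product of an
`N × ⌈N^k⌉` matrix by an `⌈N^k⌉ × N` matrix can be computed with `O(N^(w+ε))` operations. -/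
noncomputable def omega (R : Type v) [CommRing R] (k : ℝ) : ℝ :=
  sInf {w : ℝ | ∀ ε : ℝ, 0 < ε →
    (fun N : ℕ => (mulCost R N ⌈(N : ℝ) ^ k⌉₊ N : ℝ)) =O[atTop] fun N : ℕ => (N : ℝ) ^ (w + ε)}

/-! ### The exponent of the algorithm -/

/-- The binary entropy function (in bits): `H x = log₂ (x^(-x) (1-x)^(x-1))`. -/
noncomputable def H (x : ℝ) : ℝ := Real.binEntropy x / Real.log 2

/-- `α = κ H(σ/κ)`; here `0 / 0 = 0`. -/
noncomputable def alpha (σ κ : ℝ) : ℝ := κ * H (σ / κ)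

/-- `β = 1 - κ + κ H(max {σ/κ, 1/2})`. -/
noncomputable def beta (σ κ : ℝ) : ℝ := 1 - κ + κ * H (max (σ / κ) (1 / 2))

/-- `b (ω(a/b) - 2)`, continued to `b = 0` by its limit `a`. -/
noncomputable def mulTerm (R : Type v) [CommRing R] (a b : ℝ) : ℝ :=
  if b = 0 then a else b * (omega R (a / b) - 2)

/-- The expression under the max-min. -/
noncomputable def Gam (R : Type v) [CommRing R] (σ₁ σ₂ κ₁ κ₂ : ℝ) : ℝ :=
  H σ₁ + H σ₂ - alpha σ₁ κ₁ - alpha σ₂ κ₂ + beta σ₁ κ₁ + beta σ₂ κ₂ +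
    mulTerm R (alpha σ₁ κ₁ + alpha σ₂ κ₂) (min (beta σ₁ κ₁) (beta σ₂ κ₂))

/-- `m` is the minimum of `Gam R σ₁ σ₂ κ₁ κ₂` over `σ₁ ≤ κ₁ ≤ 1` and `σ₂ ≤ κ₂ ≤ 1`. -/
def IsMinOverKappa (R : Type v) [CommRing R] (σ₁ σ₂ m : ℝ) : Prop :=
  IsLeast {x | ∃ κ₁ ∈ Set.Icc σ₁ 1, ∃ κ₂ ∈ Set.Icc σ₂ 1, x = Gam R σ₁ σ₂ κ₁ κ₂} m

/-- `γ` is the maximum over `(σ₁, σ₂) ∈ [0,1]²` of the minimum over `κ₁, κ₂`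
(all these minima exist, and so does the maximum). -/
def IsMaxMin (R : Type v) [CommRing R] (γ : ℝ) : Prop :=
  (∀ σ₁ ∈ Set.Icc (0 : ℝ) 1, ∀ σ₂ ∈ Set.Icc (0 : ℝ) 1, ∃ m, IsMinOverKappa R σ₁ σ₂ m) ∧
  IsGreatest {m | ∃ σ₁ ∈ Set.Icc (0 : ℝ) 1, ∃ σ₂ ∈ Set.Icc (0 : ℝ) 1,
    IsMinOverKappa R σ₁ σ₂ m} γ

/-! ### Computations that count their ring operations -/

/-- A result together with the number of arithmetic operations spent on it. -/
structure Counted (α : Type u) : Type u where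
  val : α
  cost : ℕ

namespace Counted

instance : Monad Counted where
  pure a := ⟨a, 0⟩
  bind x g := ⟨(g x.val).val, x.cost + (g x.val).cost⟩

/-- One addition in the ring. -/
def add {R : Type v} [CommRing R] (x y : R) : Counted R := ⟨x + y, 1⟩

/-- One multiplication in the ring. -/
def mul {R : Type v} [CommRing R] (x y : R) : Counted R := ⟨x * y, 1⟩

/-- Run a straight-line program. -/
def runSLP {R : Type v} [CommRing R] {ι : Type w} {o : Type u} (P : SLP R ι o) (x : ι → R) :
    Counted (o → R) := ⟨P.eval x, P.size⟩

/-- The loop `for i ∈ s do A[i] ← c i`, whose iterations are independent of each other. -/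
def forAll {ι : Type w} [DecidableEq ι] {β : Type v} (s : Finset ι) (A : ι → β)
    (c : ι → Counted β) : Counted (ι → β) :=
  ⟨fun i => if i ∈ s then (c i).val else A i, ∑ i ∈ s, (c i).cost⟩

end Counted

/-! ### The multi-subset transform and the algorithm -/

section Algorithm

variable {R : Type v} [CommRing R] {U : Type u} [Fintype U] [DecidableEq U]

/-- The multi-subset transform `g(T) = ∑_{S ⊆ T} ∏_{i ∈ T} f_i(S)`. -/
def multiSubsetTransform (f : U → Finset U → R) (T : Finset U) : R :=
  ∑ S ∈ T.powerset, ∏ i ∈ T, f i S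

/-- The `s`-subsets of `K` that are contained in none of the sets in `prev`. -/
def uncovered (s : ℕ) (prev : List (Finset U)) (K : Finset U) : Finset (Finset U) :=
  (K.powersetCard s).filter fun S => ∀ K' ∈ prev, ¬ S ⊆ K'

/-- `𝒦` is a possible output of the greedy set cover algorithm for covering the `s`-subsets of
`V` by `k`-subsets of `V`: each set of the list is a `k`-subset of `V` that covers the largest
possible number (at least one) of the `s`-subsets not covered by its predecessors, and in the
end every `s`-subset of `V` is covered. -/
structure IsGreedyCoveringDesign (V : Finset U) (s k : ℕ) (𝒦 : List (Finset U)) : Prop where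
  mem : ∀ K ∈ 𝒦, K ∈ V.powersetCard k
  greedy : ∀ (prev rest : List (Finset U)) (K : Finset U), 𝒦 = prev ++ K :: rest →
    0 < (uncovered s prev K).card ∧
      ∀ K' ∈ V.powersetCard k, (uncovered s prev K').card ≤ (uncovered s prev K).card
  covers : ∀ S ∈ V.powersetCard s, ∃ K ∈ 𝒦, S ⊆ K

variable (R) in
/-- What the algorithm is free to choose on a ground set partitioned into `U₁`, `U₂` of size `h`:
the sizes `k s₁ s₂ = (k₁, k₂)`, which minimise the exponent over all admissible integers,
the covering designs, which are found by the greedy algorithm (ties broken arbitrarily),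
and the programs for matrix products with given index sets, which have the fewest operations. -/
structure Choices (h : ℕ) (U₁ U₂ : Finset U) where
  k : ℕ → ℕ → ℕ × ℕ
  design₁ : ℕ → ℕ → List (Finset U)
  design₂ : ℕ → ℕ → List (Finset U)
  rmm : ∀ 𝒯₁ 𝒮 𝒯₂ : Finset (Finset U), MatProgram R 𝒯₁ 𝒯₂ 𝒮
  k_mem : ∀ s₁ ≤ h, ∀ s₂ ≤ h,
    (k s₁ s₂).1 ∈ Finset.Icc s₁ h ∧ (k s₁ s₂).2 ∈ Finset.Icc s₂ h
  k_min : ∀ s₁ ≤ h, ∀ s₂ ≤ h, ∀ k₁ ∈ Finset.Icc s₁ h, ∀ k₂ ∈ Finset.Icc s₂ h,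
    Gam R (s₁ / h) (s₂ / h) ((k s₁ s₂).1 / h) ((k s₁ s₂).2 / h) ≤
      Gam R (s₁ / h) (s₂ / h) (k₁ / h) (k₂ / h)
  design₁_greedy : ∀ s k, s ≤ k → k ≤ h → IsGreedyCoveringDesign U₁ s k (design₁ s k)
  design₂_greedy : ∀ s k, s ≤ k → k ≤ h → IsGreedyCoveringDesign U₂ s k (design₂ s k)
  rmm_optimal : ∀ 𝒯₁ 𝒮 𝒯₂, (rmm 𝒯₁ 𝒮 𝒯₂).Optimal

/-- The matrix `F_p(T_p, S) = [S ∩ U_p ⊆ T_p] ∏_{i ∈ T_p} f_i(S)` with rows `T_p ⊆ U_p` and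
columns `S ⊆ U`, as a table indexed by the pairs `(T_p, S)`. Only the entries with
`S ∩ U_p ⊆ T_p` are computed, by `|T_p|` multiplications each; the others are zero. -/
noncomputable def computeF (V : Finset U) (f : U → Finset U → R) :
    Counted (Finset U × Finset U → R) :=
  Counted.forAll ((V.powerset ×ˢ Finset.univ).filter fun p => p.2 ∩ V ⊆ p.1) (fun _ => 0)
    fun p => p.1.toList.foldlM (fun acc i => Counted.mul acc (f i p.2)) 1

/-- The columns `{S₁ ∪ S₂ : S₁ ∈ (K₁ choose s₁), S₂ ∈ (K₂ choose s₂)}`. -/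
def columns (s₁ s₂ : ℕ) (K₁ K₂ : Finset U) : Finset (Finset U) :=
  (K₁.powersetCard s₁ ×ˢ K₂.powersetCard s₂).image fun p => p.1 ∪ p.2

/-- The rows that remain after trimming: those `T_p ⊆ U_p` with `|T_p ∩ K_p| ≥ s_p`. -/
def rows (V : Finset U) (s : ℕ) (K : Finset U) : Finset (Finset U) :=
  V.powerset.filter fun T => s ≤ (T ∩ K).card

/-- The matrix product `E₁ E₂ᵀ`, where `E_p` keeps the rows `𝒯_p` and the columns `𝒮` of `F_p`. -/
def fastRMM {h : ℕ} {U₁ U₂ : Finset U} (ch : Choices R h U₁ U₂)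
    (F₁ F₂ : Finset U × Finset U → R) (𝒯₁ 𝒮 𝒯₂ : Finset (Finset U)) :
    Counted (𝒯₁ × 𝒯₂ → R) :=
  Counted.runSLP (ch.rmm 𝒯₁ 𝒮 𝒯₂)
    (Sum.elim (fun p => F₁ (p.1, p.2)) (fun p => F₂ (p.2, p.1)))

/-- Missing entries are zero. -/
def extendByZero {𝒯₁ 𝒯₂ : Finset (Finset U)} (E : 𝒯₁ × 𝒯₂ → R) (T₁ T₂ : Finset U) : R :=
  if hT : T₁ ∈ 𝒯₁ ∧ T₂ ∈ 𝒯₂ then E (⟨T₁, hT.1⟩, ⟨T₂, hT.2⟩) else 0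

/-- One pass of the inner loop, for a pair `K = (K₁, K₂)`. The state is the table `G` together
with the set `𝒞` of the columns that are already covered. -/
def innerStep {h : ℕ} {U₁ U₂ : Finset U} (ch : Choices R h U₁ U₂)
    (F₁ F₂ : Finset U × Finset U → R) (s₁ s₂ : ℕ)
    (st : (Finset U → R) × Finset (Finset U)) (K : Finset U × Finset U) :
    Counted ((Finset U → R) × Finset (Finset U)) := do
  let G := st.1
  let 𝒞 := st.2
  let 𝒮 := columns s₁ s₂ K.1 K.2
  let 𝒯₁ := rows U₁ s₁ K.1
  let 𝒯₂ := rows U₂ s₂ K.2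
  let E ← fastRMM ch F₁ F₂ 𝒯₁ (𝒮 \ 𝒞) 𝒯₂
  let G' ← Counted.forAll (Finset.univ.filter fun T => T ∩ U₁ ∈ 𝒯₁ ∧ T ∩ U₂ ∈ 𝒯₂) G
    fun T => Counted.add (G T) (extendByZero E (T ∩ U₁) (T ∩ U₂))
  return (G', 𝒞 ∪ 𝒮)

/-- One pass of the outer loop, for a pair `s = (s₁, s₂)`. -/
def outerStep {h : ℕ} {U₁ U₂ : Finset U} (ch : Choices R h U₁ U₂)
    (F₁ F₂ : Finset U × Finset U → R)
    (st : (Finset U → R) × Finset (Finset U)) (s : ℕ × ℕ) :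
    Counted ((Finset U → R) × Finset (Finset U)) :=
  let k := ch.k s.1 s.2
  let 𝒦₁ := ch.design₁ s.1 k.1
  let 𝒦₂ := ch.design₂ s.2 k.2
  (𝒦₁ ×ˢ 𝒦₂).foldlM (innerStep ch F₁ F₂ s.1 s.2) st

/-- The algorithm Cover-Columns for the multi-subset transform. -/
noncomputable def coverColumns {h : ℕ} {U₁ U₂ : Finset U} (ch : Choices R h U₁ U₂)
    (f : U → Finset U → R) : Counted (Finset U → R) := do
  let F₁ ← computeF U₁ f
  let F₂ ← computeF U₂ f
  let res ← (List.range (h + 1) ×ˢ List.range (h + 1)).foldlM (outerStep ch F₁ F₂)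
    ((fun _ => 0), ∅)
  return res.1

end Algorithm

end CoverColumns

/-! Correctness. The table `G` always holds exactly the contributions of the columns in `𝒞`
(`TableInvariant`). A set `S ⊆ T` contributes `∏ i ∈ T, f i S`, which factors over `T ∩ U₁` and `T ∩
U₂`, so a matrix product adds the contributions of all its columns at once. Trimming the rows is
harmless: if `S ⊆ T` and the part of `S` in `U_p` is an `s_p`-subset of `K_p`, then `|T ∩ K_p| ≥
s_p`. Removing `𝒞` from the columns prevents double counting. Every `S` is reached in the pass for
`(|S ∩ U₁|, |S ∩ U₂|)`, because the designs cover all subsets of these sizes.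

Cost. With `σ = s/h` and `κ = k/h`, greedy designs have at most `2 ^ ((H σ - α) h)` members up to a
polynomial factor, the trimmed matrices have at most `2 ^ (β_p h)` rows, and there are at most `2 ^
((α₁ + α₂) h)` columns. A product of this shape, cut into blocks of side about `2 ^ (min β₁ β₂ *
h)`, contributes the remaining terms of `Gam`. What needs care is that all constants be uniform in
the shape. The ratio `(α₁ + α₂) / min β₁ β₂` can be unbounded, but `a - b ≤ mulTerm R a b ≤ a` shows
that the school method is good enough for small `b`; the other ratios lie in a compact interval,
where monotonicity and the Lipschitz property of `omega` reduce everything to a finite grid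
(`exists_mulCost_square_le`).

The max-min. The bounds `max 2 (1 + k) ≤ ω(k) ≤ 2 + k` and the Lipschitz property make `Gam`
continuous on a compact set, including the points where a denominator vanishes. Hence the max-min is
attained, and uniform continuity transfers the real minimisation to integers `k_p`
(`exists_rounding`). The tables `F_p` cost about `6 ^ h` operations; this is absorbed because `2 ^ γ
≥ 6` (`six_le_rpow_maxMin`). -/

namespace CoverColumns

open Filter Asymptotics

/-! ### Composing straight-line programs -/

section Straightline

variable {R : Type v} [CommRing R] {ι : Type w}

/-- The results of a piece of code, appended to the results `rs` of earlier code. -/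
def runFrom (x : ι → R) (rs : List R) (c : List (Instr R ι)) : List R :=
  c.foldl (fun rs ins => rs ++ [ins.eval x rs]) rs

lemma runFrom_append (x : ι → R) (rs : List R) (c d : List (Instr R ι)) :
    runFrom x rs (c ++ d) = runFrom x (runFrom x rs c) d := by
  simp [runFrom]

lemma exists_runFrom_eq (x : ι → R) (c : List (Instr R ι)) (rs : List R) :
    ∃ t, runFrom x rs c = rs ++ t ∧ t.length = c.length := by
  induction c generalizing rs with
  | nil => exact ⟨[], by simp [runFrom]⟩
  | cons i c ih =>
    obtain ⟨t, ht, hl⟩ := ih (rs ++ [i.eval x rs])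
    exact ⟨i.eval x rs :: t, by simpa [runFrom] using ht, by simp [hl]⟩

lemma length_runFrom (x : ι → R) (c : List (Instr R ι)) (rs : List R) :
    (runFrom x rs c).length = rs.length + c.length := by
  obtain ⟨t, ht, hl⟩ := exists_runFrom_eq x c rs
  simp [ht, hl]

/-- The operand `op` has the value `φ x` for all inputs `x` once the code `c` has been run, and
keeps it whatever is run afterwards. -/
def Represents (c : List (Instr R ι)) (op : Operand R ι) (φ : (ι → R) → R) : Prop :=
  ∀ x t, op.eval x (runFrom x [] c ++ t) = φ x

/-- The functions of the inputs that can be read off after the code `c` has been run. -/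
def avail (c : List (Instr R ι)) : Set ((ι → R) → R) := {φ | ∃ op, Represents c op φ}

lemma Represents.append {c : List (Instr R ι)} {op : Operand R ι} {φ : (ι → R) → R}
    (h : Represents c op φ) (d : List (Instr R ι)) : Represents (c ++ d) op φ := by
  intro x t
  obtain ⟨s, hs, -⟩ := exists_runFrom_eq x d (runFrom x [] c)
  rw [runFrom_append, hs, List.append_assoc]
  exact h x _

lemma avail_append (c d : List (Instr R ι)) : avail c ⊆ avail (c ++ d) :=
  fun _ ⟨op, h⟩ => ⟨op, h.append d⟩

lemma const_mem_avail (c : List (Instr R ι)) (a : R) : (fun _ => a) ∈ avail c :=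
  ⟨.const a, fun _ _ => rfl⟩

lemma input_mem_avail (c : List (Instr R ι)) (i : ι) : (fun x => x i) ∈ avail c :=
  ⟨.input i, fun _ _ => rfl⟩

lemma mem_avail_snoc (c : List (Instr R ι)) (i : Instr R ι) :
    (fun x => i.eval x (runFrom x [] c)) ∈ avail (c ++ [i]) := by
  refine ⟨.reg c.length, fun x t => ?_⟩
  have h := length_runFrom x c []
  simp only [List.length_nil, zero_add] at h
  rw [runFrom_append, Operand.eval]
  simp [runFrom] at h ⊢
  rw [List.getElem?_append_right (by simp [h])]
  simp [h]

/-- `m` operations suffice for computing all functions in `T` from those in `A`. -/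
def Computes (A : Set ((ι → R) → R)) (m : ℕ) (T : Set ((ι → R) → R)) : Prop :=
  ∀ c, A ⊆ avail c → ∃ d, d.length ≤ m ∧ T ⊆ avail (c ++ d)

lemma Computes.mono {A A' T T' : Set ((ι → R) → R)} {m m' : ℕ} (h : Computes A m T)
    (hA : A ⊆ A') (hm : m ≤ m') (hT : T' ⊆ T) : Computes A' m' T' := fun c hc => by
  obtain ⟨d, h1, h2⟩ := h c (hA.trans hc)
  exact ⟨d, h1.trans hm, hT.trans h2⟩

/-- `Computes` quantifies over all code that may precede, so two pieces can be concatenated without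
any bookkeeping of registers. -/
lemma Computes.trans {A B T : Set ((ι → R) → R)} {m n : ℕ} (h : Computes A m B)
    (h' : Computes (A ∪ B) n T) : Computes A (m + n) (B ∪ T) := fun c hc => by
  obtain ⟨d, h1, h2⟩ := h c hc
  obtain ⟨e, h3, h4⟩ := h' (c ++ d) (Set.union_subset (hc.trans (avail_append _ _)) h2)
  refine ⟨d ++ e, by simp; omega, ?_⟩
  rw [← List.append_assoc]
  exact Set.union_subset (h2.trans (avail_append _ _)) h4

lemma Computes.biUnion {τ : Type*} (s : Finset τ) {A : Set ((ι → R) → R)} {m : ℕ}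
    {T : τ → Set ((ι → R) → R)} (h : ∀ t ∈ s, Computes A m (T t)) :
    Computes A (s.card * m) (⋃ t ∈ s, T t) := by
  classical
  induction s using Finset.induction_on with
  | empty => exact fun c _ => ⟨[], by simp⟩
  | insert a s ha ih =>
    have h1 := ih fun t ht => h t (Finset.mem_insert_of_mem ht)
    have h2 := h1.trans ((h a (Finset.mem_insert_self a s)).mono Set.subset_union_left le_rfl
      Set.Subset.rfl)
    refine h2.mono Set.Subset.rfl (by rw [Finset.card_insert_of_notMem ha]; linarith) ?_
    rw [Finset.set_biUnion_insert, Set.union_comm]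

lemma Computes.iUnion {τ : Type*} [Fintype τ] {A : Set ((ι → R) → R)} {m : ℕ}
    {T : τ → Set ((ι → R) → R)} (h : ∀ t, Computes A m (T t)) :
    Computes A (Fintype.card τ * m) (⋃ t, T t) := by
  simpa using Computes.biUnion Finset.univ (fun t _ => h t)

lemma computes_add (φ ψ : (ι → R) → R) : Computes {φ, ψ} 1 {φ + ψ} := fun c hc => by
  obtain ⟨p, hp⟩ := hc (Set.mem_insert φ _)
  obtain ⟨q, hq⟩ := hc (Set.mem_insert_of_mem φ rfl)
  refine ⟨[.add p q], by simp, ?_⟩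
  have := mem_avail_snoc c (.add p q)
  rw [Set.singleton_subset_iff]
  convert this using 1
  funext x
  have h1 := hp x []
  have h2 := hq x []
  simp only [List.append_nil] at h1 h2
  simp [Instr.eval, h1, h2]

lemma computes_mul (φ ψ : (ι → R) → R) : Computes {φ, ψ} 1 {φ * ψ} := fun c hc => by
  obtain ⟨p, hp⟩ := hc (Set.mem_insert φ _)
  obtain ⟨q, hq⟩ := hc (Set.mem_insert_of_mem φ rfl)
  refine ⟨[.mul p q], by simp, ?_⟩
  have := mem_avail_snoc c (.mul p q)
  rw [Set.singleton_subset_iff]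
  convert this using 1
  funext x
  have h1 := hp x []
  have h2 := hq x []
  simp only [List.append_nil] at h1 h2
  simp [Instr.eval, h1, h2]

/-- The summation starts from the constant `0`, which is free; hence one addition per term. -/
lemma computes_sum {τ : Type*} (s : Finset τ) (φ : τ → (ι → R) → R) :
    Computes (φ '' s) s.card {∑ t ∈ s, φ t} := by
  classical
  induction s using Finset.induction_on with
  | empty =>
    refine fun c _ => ⟨[], by simp, ?_⟩
    rw [Set.singleton_subset_iff]
    exact const_mem_avail _ 0
  | insert a s ha ih =>
    rw [Finset.sum_insert ha, Finset.card_insert_of_notMem ha]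
    have h1 : Computes (φ '' (insert a s : Finset τ)) s.card {∑ t ∈ s, φ t} :=
      ih.mono (Set.image_mono (by simp)) le_rfl Set.Subset.rfl
    have h2 := h1.trans ((computes_add (φ a) (∑ t ∈ s, φ t)).mono (A' := _)
      (by
        intro ψ hψ
        rcases hψ with rfl | hψ
        · exact Or.inl ⟨a, by simp, rfl⟩
        · exact Or.inr hψ) le_rfl Set.Subset.rfl)
    exact h2.mono Set.Subset.rfl le_rfl Set.subset_union_right

/-! ### Running a program inside another one -/

variable {κ o : Type*}

/-- Replace the inputs by the operands `σ` and the registers by those that start at `n`. -/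
def Operand.relocate (n : ℕ) (σ : κ → Operand R ι) : Operand R κ → Operand R ι
  | .const c => .const c
  | .input i => σ i
  | .reg j => .reg (n + j)

def Instr.relocate (n : ℕ) (σ : κ → Operand R ι) : Instr R κ → Instr R ι
  | .add p q => .add (p.relocate n σ) (q.relocate n σ)
  | .mul p q => .mul (p.relocate n σ) (q.relocate n σ)

lemma Operand.eval_relocate {n : ℕ} {σ : κ → Operand R ι} {x : ι → R} {y : κ → R} {rs : List R}
    (hn : rs.length = n) (hσ : ∀ i t, (σ i).eval x (rs ++ t) = y i) (t : List R)
    (p : Operand R κ) : (p.relocate n σ).eval x (rs ++ t) = p.eval y t := by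
  cases p with
  | const c => rfl
  | input i => exact hσ i t
  | reg j => simp [Operand.relocate, Operand.eval, ← hn, List.getElem?_append_right]

lemma runFrom_relocate {n : ℕ} {σ : κ → Operand R ι} {x : ι → R} {y : κ → R} {rs : List R}
    (hn : rs.length = n) (hσ : ∀ i t, (σ i).eval x (rs ++ t) = y i) (c : List (Instr R κ))
    (t : List R) :
    runFrom x (rs ++ t) (c.map (Instr.relocate n σ)) = rs ++ runFrom y t c := by
  induction c generalizing t with
  | nil => simp [runFrom]
  | cons i c ih =>
    have h : (i.relocate n σ).eval x (rs ++ t) = i.eval y t := by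
      cases i <;> simp [Instr.relocate, Instr.eval, Operand.eval_relocate hn hσ]
    have := ih (t ++ [i.eval y t])
    simp only [runFrom, List.map_cons, List.foldl_cons, h] at this ⊢
    rw [← this, List.append_assoc]

/-- A register that is never written reads as `0`. -/
def Operand.settle (n : ℕ) : Operand R κ → Operand R κ
  | .reg j => if j < n then .reg j else .const 0
  | p => p

lemma Operand.eval_settle (x : κ → R) (rs t : List R) (p : Operand R κ) :
    (p.settle rs.length).eval x (rs ++ t) = p.eval x rs := by
  cases p with
  | const c => rfl
  | input i => rfl
  | reg j =>
    simp only [Operand.settle]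
    split_ifs with h
    · simp [Operand.eval, List.getElem?_append_left h]
    · simp [Operand.eval, List.getElem?_eq_none (not_lt.mp h)]

/-- A program can be run as a part of another one. -/
lemma SLP.computes (P : SLP R κ o) (y : κ → (ι → R) → R) :
    Computes (Set.range y) P.size (Set.range fun j x => P.eval (fun i => y i x) j) := by
  intro c hc
  choose σ hσ using fun i => hc ⟨i, rfl⟩
  refine ⟨P.code.map (Instr.relocate c.length σ), by simp [SLP.size], ?_⟩
  rintro _ ⟨j, rfl⟩
  -- An output may refer to a register that `P` never writes. Later code would write there, so
  -- `settle` replaces such an output by the constant `0`.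
  refine ⟨((P.out j).settle P.code.length).relocate c.length σ, fun x t => ?_⟩
  have hl : (runFrom x [] c).length = c.length := by simp [length_runFrom]
  have h1 := runFrom_relocate hl (fun i t => hσ i x t) P.code []
  rw [List.append_nil] at h1
  rw [runFrom_append, h1, List.append_assoc,
    Operand.eval_relocate hl (fun i t => hσ i x t)]
  have h2 := length_runFrom (fun i => y i x) P.code []
  simp only [List.length_nil, zero_add] at h2
  have h3 := Operand.eval_settle (fun i => y i x) (runFrom (fun i => y i x) [] P.code) t (P.out j)
  rw [h2] at h3
  exact h3

lemma Computes.exists_program {m : ℕ} {φ : o → (ι → R) → R} {A : Set ((ι → R) → R)}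
    (hA : A ⊆ avail []) (h : Computes A m (Set.range φ)) :
    ∃ P : SLP R ι o, P.size ≤ m ∧ ∀ x j, P.eval x j = φ j x := by
  obtain ⟨d, hd, hT⟩ := h [] hA
  choose op hop using fun j => hT ⟨j, rfl⟩
  refine ⟨⟨d, op⟩, hd, fun x j => ?_⟩
  have := hop j x []
  simpa [SLP.eval, SLP.regs, runFrom] using this

end Straightline

/-! ### Programs for matrix products -/

section MatrixPrograms

open Matrix

/-- `m` operations suffice for the product of an `α × γ` matrix and a `γ × β` matrix. -/
def MulIn (R : Type v) [CommRing R] (α β γ : Type w) [Fintype γ] (m : ℕ) : Prop :=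
  ∃ P : MatProgram R α β γ, P.Correct ∧ SLP.size P ≤ m

variable {R : Type v} [CommRing R]

/-- The entries of the matrix product as functions of the inputs of a program. -/
def prodEntry (R : Type v) [CommRing R] {α β γ : Type w} [Fintype γ] (p : α × β)
    (x : (α × γ) ⊕ (γ × β) → R) : R :=
  ∑ k, x (.inl (p.1, k)) * x (.inr (k, p.2))

lemma MatProgram.Correct.eval_eq {α β γ : Type w} [Fintype γ] {P : MatProgram R α β γ}
    (hP : P.Correct) (x : (α × γ) ⊕ (γ × β) → R) (p : α × β) :
    SLP.eval P x p = prodEntry R p x := by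
  have h := hP (Matrix.of fun i k => x (.inl (i, k))) (Matrix.of fun k j => x (.inr (k, j))) p.1 p.2
  rw [Matrix.mul_apply] at h
  simp only [Matrix.of_apply] at h
  rw [prodEntry, ← h]
  congr 1
  funext q
  rcases q with q | q <;> rfl

lemma mulIn_iff_computes {α β γ : Type w} [Fintype γ] {m : ℕ} :
    MulIn R α β γ m ↔ Computes (Set.range fun q (x : (α × γ) ⊕ (γ × β) → R) => x q) m
      (Set.range fun p => prodEntry R (γ := γ) (α := α) (β := β) p) := by
  constructor
  · rintro ⟨P, hP, hm⟩
    refine (SLP.computes P fun q x => x q).mono Set.Subset.rfl hm ?_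
    rintro _ ⟨p, rfl⟩
    exact ⟨p, funext fun x => hP.eval_eq x p⟩
  · intro h
    obtain ⟨P, hm, hP⟩ := h.exists_program (by rintro _ ⟨q, rfl⟩; exact input_mem_avail _ _)
    refine ⟨P, fun A B i j => ?_, hm⟩
    rw [hP]
    simp [prodEntry, Matrix.mul_apply]

/-- Sub-matrices can be multiplied by means of a program for larger matrices. -/
lemma MulIn.of_embedding {α β γ : Type u} {α' β' γ' : Type w} [Fintype γ] [Fintype γ'] {m : ℕ}
    (h : MulIn R α β γ m) (fa : α' ↪ α) (fb : β' ↪ β) (fc : γ' ↪ γ) : MulIn R α' β' γ' m := by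
  classical
  obtain ⟨P, hP, hm⟩ := h
  -- The small matrices are padded with zeros; a zero is a constant operand and costs nothing.
  let y : (α × γ) ⊕ (γ × β) → ((α' × γ') ⊕ (γ' × β') → R) → R :=
    Sum.elim (fun q x => Function.extend (Prod.map fa fc) (fun p => x (.inl p)) 0 q)
      (fun q x => Function.extend (Prod.map fc fb) (fun p => x (.inr p)) 0 q)
  have hia : Function.Injective (Prod.map fa fc) := fa.injective.prodMap fc.injective
  have hib : Function.Injective (Prod.map fc fb) := fc.injective.prodMap fb.injective
  have hy : Set.range y ⊆ avail [] := by
    rintro _ ⟨q, rfl⟩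
    rcases q with q | q
    · by_cases hq : ∃ p, Prod.map fa fc p = q
      · obtain ⟨p, rfl⟩ := hq
        convert input_mem_avail [] (Sum.inl p) using 1
        funext x
        exact hia.extend_apply (fun p => x (.inl p)) 0 p
      · convert const_mem_avail [] (0 : R) using 1
        funext x
        exact Function.extend_apply' (fun p => x (.inl p)) (0 : α × γ → R) q hq
    · by_cases hq : ∃ p, Prod.map fc fb p = q
      · obtain ⟨p, rfl⟩ := hq
        convert input_mem_avail [] (Sum.inr p) using 1
        funext x
        exact hib.extend_apply (fun p => x (.inr p)) 0 p
      · convert const_mem_avail [] (0 : R) using 1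
        funext x
        exact Function.extend_apply' (fun p => x (.inr p)) (0 : γ × β → R) q hq
  have h1 : Computes (Set.range y) m (Set.range fun p => prodEntry R (γ := γ') (α := α') (β := β') p) := by
    refine (SLP.computes P y).mono Set.Subset.rfl hm ?_
    rintro _ ⟨⟨i, j⟩, rfl⟩
    refine ⟨(fa i, fb j), funext fun x => ?_⟩
    refine (hP.eval_eq _ _).trans ?_
    simp only [prodEntry, y, Sum.elim_inl, Sum.elim_inr]
    -- Inner indices outside the range of `fc` meet only padding, so the large sum collapses to the
    -- small one.
    refine (Finset.sum_of_injOn fc fc.injective.injOn (fun _ _ => by simp) ?_ ?_).symm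
    · intro k _ hk
      rw [Function.extend_apply', Pi.zero_apply, zero_mul]
      rintro ⟨⟨a, b⟩, hab⟩
      simp only [Prod.map_apply, Prod.mk.injEq] at hab
      exact hk ⟨b, by simp, hab.2⟩
    · intro k _
      have e1 := hia.extend_apply (fun p => x (.inl p)) 0 (i, k)
      have e2 := hib.extend_apply (fun p => x (.inr p)) 0 (k, j)
      simp only [Prod.map_apply] at e1 e2
      rw [e1, e2]
  obtain ⟨Q, hQ, hQ'⟩ := h1.exists_program hy
  refine ⟨Q, fun A B i j => ?_, hQ⟩
  rw [hQ']
  simp [prodEntry, Matrix.mul_apply]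

/-- Multiplication of block matrices. -/
lemma MulIn.blocks {α β γ I J K : Type w} [Fintype α] [Fintype β] [Fintype γ] [Fintype I]
    [Fintype J] [Fintype K] {m : ℕ} (h : MulIn R α β γ m) :
    MulIn R (I × α) (J × β) (K × γ) (Fintype.card I * Fintype.card J * Fintype.card K *
      (m + Fintype.card α * Fintype.card β)) := by
  classical
  rw [mulIn_iff_computes]
  obtain ⟨P, hP, hm⟩ := h
  let y (t : I × J × K) :
      (α × γ) ⊕ (γ × β) → (((I × α) × (K × γ)) ⊕ ((K × γ) × (J × β)) → R) → R :=
    Sum.elim (fun q x => x (.inl ((t.1, q.1), (t.2.2, q.2))))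
      (fun q x => x (.inr ((t.2.2, q.1), (t.2.1, q.2))))
  have h1 (t) : Computes (Set.range fun q
      (x : ((I × α) × (K × γ)) ⊕ ((K × γ) × (J × β)) → R) => x q) m
      (Set.range fun (p : α × β) x => prodEntry R p fun q => y t q x) := by
    refine (SLP.computes P (y t)).mono ?_ hm ?_
    · rintro _ ⟨q, rfl⟩
      rcases q with q | q <;> exact ⟨_, rfl⟩
    · rintro _ ⟨p, rfl⟩
      exact ⟨p, funext fun x => hP.eval_eq _ p⟩
  have h2 := Computes.iUnion h1
  -- All block products are available now. Each entry of the result is a sum over `K` of their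
  -- entries, which accounts for the summand `card α * card β` per block product.
  have h3 (t : (I × J) × (α × β)) := computes_sum (Finset.univ : Finset K)
    fun k (x : ((I × α) × (K × γ)) ⊕ ((K × γ) × (J × β)) → R) =>
      prodEntry R t.2 fun q => y (t.1.1, t.1.2, k) q x
  have h4 := Computes.iUnion fun t => (h3 t).mono
    (A' := (Set.range fun q (x : ((I × α) × (K × γ)) ⊕ ((K × γ) × (J × β)) → R) => x q) ∪
      ⋃ t, Set.range fun (p : α × β) x => prodEntry R p fun q => y t q x) (by
        rintro _ ⟨k, -, rfl⟩
        exact Or.inr (Set.mem_iUnion.2 ⟨(t.1.1, t.1.2, k), t.2, rfl⟩)) le_rfl Set.Subset.rfl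
  refine (h2.trans h4).mono Set.Subset.rfl ?_ ?_
  · simp only [Fintype.card_prod, Finset.card_univ]
    apply le_of_eq
    ring
  · rintro _ ⟨⟨⟨i, a⟩, ⟨j, b⟩⟩, rfl⟩
    refine Or.inr (Set.mem_iUnion.2 ⟨((i, j), (a, b)), ?_⟩)
    funext x
    simp [prodEntry, Fintype.sum_prod_type, y]

lemma mulIn_unit : MulIn R (Fin 1) (Fin 1) (Fin 1) 1 := by
  rw [mulIn_iff_computes]
  refine (computes_mul (fun x => x (.inl (0, 0))) (fun x => x (.inr (0, 0)))).mono ?_ le_rfl ?_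
  · rintro _ (rfl | rfl) <;> exact ⟨_, rfl⟩
  · rintro _ ⟨⟨i, j⟩, rfl⟩
    rw [Set.mem_singleton_iff]
    funext x
    simp [prodEntry, Subsingleton.elim i 0, Subsingleton.elim j 0]

/-- The school method. -/
lemma mulIn_naive (a b c : ℕ) : MulIn R (Fin a) (Fin b) (Fin c) (a * b * c * 2) := by
  -- The blocks are single entries: one multiplication and one addition for each triple of indices.
  have h := (mulIn_unit (R := R)).blocks (I := Fin a) (J := Fin b) (K := Fin c)
  simp only [Fintype.card_fin] at h
  exact h.of_embedding ⟨fun i => (i, 0), fun i j h => (Prod.ext_iff.1 h).1⟩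
    ⟨fun i => (i, 0), fun i j h => (Prod.ext_iff.1 h).1⟩
    ⟨fun i => (i, 0), fun i j h => (Prod.ext_iff.1 h).1⟩

variable (R) in
lemma mulIn_mulCost (a c b : ℕ) : MulIn R (Fin a) (Fin b) (Fin c) (mulCost R a c b) := by
  obtain ⟨P, hP, -⟩ := mulIn_naive (R := R) a b c
  have h := Nat.sInf_mem (s := {m | ∃ P : MatProgram R (Fin a) (Fin b) (Fin c),
    P.Correct ∧ SLP.size P = m}) ⟨SLP.size P, P, hP, rfl⟩
  obtain ⟨Q, hQ, hm⟩ := h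
  exact ⟨Q, hQ, hm.le⟩

lemma mulCost_le_of_mulIn {a b c m : ℕ} (h : MulIn R (Fin a) (Fin b) (Fin c) m) :
    mulCost R a c b ≤ m := by
  obtain ⟨P, hP, hm⟩ := h
  have h : mulCost R a c b ≤ SLP.size P := Nat.sInf_le ⟨P, hP, rfl⟩
  exact h.trans hm

variable (R)

lemma mulCost_le_naive (a b c : ℕ) : mulCost R a c b ≤ a * b * c * 2 :=
  mulCost_le_of_mulIn (mulIn_naive a b c)

lemma mulCost_mono {a b c a' b' c' : ℕ} (ha : a ≤ a') (hb : b ≤ b') (hc : c ≤ c') :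
    mulCost R a c b ≤ mulCost R a' c' b' :=
  mulCost_le_of_mulIn ((mulIn_mulCost R a' c' b').of_embedding (Fin.castLEEmb ha)
    (Fin.castLEEmb hb) (Fin.castLEEmb hc))

lemma mulCost_mul_le (p q r a b c : ℕ) :
    mulCost R (p * a) (r * c) (q * b) ≤ p * q * r * (mulCost R a c b + a * b) := by
  have h := (mulIn_mulCost R a c b).blocks (I := Fin p) (J := Fin q) (K := Fin r)
  simp only [Fintype.card_fin] at h
  exact mulCost_le_of_mulIn (h.of_embedding finProdFinEquiv.symm.toEmbedding
    finProdFinEquiv.symm.toEmbedding finProdFinEquiv.symm.toEmbedding)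

variable {R}

lemma exists_optimal {α β γ : Type w} [Fintype α] [Fintype β] [Fintype γ] :
    ∃ P : MatProgram R α β γ, P.Optimal := by
  classical
  obtain ⟨P, hP, -⟩ := (mulIn_mulCost R (Fintype.card α) (Fintype.card γ)
    (Fintype.card β)).of_embedding (Fintype.equivFin α).toEmbedding
      (Fintype.equivFin β).toEmbedding (Fintype.equivFin γ).toEmbedding
  have h : ∃ m, ∃ P : MatProgram R α β γ, P.Correct ∧ SLP.size P = m := ⟨_, P, hP, rfl⟩
  obtain ⟨Q, hQ, hm⟩ := Nat.find_spec h
  exact ⟨Q, hQ, fun Q' hQ' => hm.le.trans (Nat.find_min' h ⟨Q', hQ', rfl⟩)⟩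

lemma MatProgram.Optimal.size_le {α β γ : Type w} [Fintype α] [Fintype β] [Fintype γ]
    {P : MatProgram R α β γ} (hP : P.Optimal) :
    SLP.size P ≤ mulCost R (Fintype.card α) (Fintype.card γ) (Fintype.card β) := by
  obtain ⟨Q, hQ, hm⟩ := (mulIn_mulCost R (Fintype.card α) (Fintype.card γ)
    (Fintype.card β)).of_embedding (Fintype.equivFin α).toEmbedding
      (Fintype.equivFin β).toEmbedding (Fintype.equivFin γ).toEmbedding
  exact (hP.2 Q hQ).trans hm

/-! ### Lower bounds for the matrix product -/

section LowerBounds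

variable {α β γ : Type w} [Fintype γ] [DecidableEq α] [DecidableEq β] [DecidableEq γ]

lemma MatProgram.Correct.eval_single {P : MatProgram R α β γ} (hP : P.Correct) (i i' : α)
    (j j' : β) (k : γ) (a : R) :
    SLP.eval P (Sum.elim (fun p => Matrix.single i k a p.1 p.2)
      (fun p => Matrix.single k j (1 : R) p.1 p.2)) (i', j') =
      if i = i' ∧ j = j' then a else 0 := by
  rw [hP, Matrix.single_mul_single_same, mul_one, Matrix.single_apply]

/-- A constant cannot be both the entry `0` of a zero product and the entry `1` of a product of
matrix units. An input can be set to `1` while the other factor is zero. A register beyond the end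
of the program reads as `0`, so it never yields the entry `1`. -/
lemma MatProgram.Correct.exists_out_eq_reg [Nontrivial R] {P : MatProgram R α β γ}
    (hP : P.Correct) (k : γ) (p : α × β) : ∃ r < SLP.size P, P.out p = .reg r := by
  obtain ⟨i, j⟩ := p
  have h0 := hP 0 0 i j
  have h1 := hP.eval_single i i j j k 1
  simp only [Matrix.zero_mul, Matrix.zero_apply] at h0
  simp only [and_self, if_true] at h1
  cases hout : P.out (i, j) with
  | const c =>
    simp only [SLP.eval, hout, Operand.eval] at h0 h1
    exact absurd (h0.symm.trans h1) zero_ne_one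
  | input q =>
    exfalso
    rcases q with q | q
    · have h2 := hP (Matrix.of fun _ _ => 1) 0 i j
      simp [SLP.eval, hout, Operand.eval] at h2
    · have h2 := hP 0 (Matrix.of fun _ _ => 1) i j
      simp [SLP.eval, hout, Operand.eval] at h2
  | reg r =>
    refine ⟨r, ?_, rfl⟩
    by_contra hr
    simp only [SLP.eval, hout, Operand.eval] at h1
    rw [List.getD_eq_default] at h1
    · exact zero_ne_one h1
    · have := length_runFrom (Sum.elim (fun p => Matrix.single i k (1 : R) p.1 p.2)
        (fun p => Matrix.single k j (1 : R) p.1 p.2)) P.code []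
      simp only [List.length_nil, zero_add] at this
      exact this.le.trans (not_lt.mp hr)

/-- Different entries are read from different registers: a product of two matrix units through `k`
has the value `1` at one entry and `0` at all others. -/
lemma MatProgram.Correct.card_mul_card_le [Fintype α] [Fintype β] [Nontrivial R]
    {P : MatProgram R α β γ} (hP : P.Correct) (k : γ) :
    Fintype.card α * Fintype.card β ≤ SLP.size P := by
  choose r hr hout using hP.exists_out_eq_reg k
  rw [← Fintype.card_prod, ← Fintype.card_fin (SLP.size P)]
  refine Fintype.card_le_of_injective (fun p => (⟨r p, hr p⟩ : Fin _)) fun p q hpq => ?_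
  have hrr : r p = r q := by simpa using hpq
  have h1 := hP.eval_single p.1 p.1 p.2 p.2 k 1
  have h2 := hP.eval_single p.1 q.1 p.2 q.2 k 1
  simp only [SLP.eval, hout] at h1 h2
  rw [hrr, h2] at h1
  by_contra hne
  rw [if_neg fun h => hne (Prod.ext h.1 h.2)] at h1
  simp at h1

/-- The operands of an instruction. -/
def Instr.operands {S ι : Type*} : Instr S ι → List (Operand S ι)
  | .add p q => [p, q]
  | .mul p q => [p, q]

lemma runFrom_congr {ι : Type*} {x y : ι → R} (c : List (Instr R ι)) (rs : List R)
    (h : ∀ i, Operand.input i ∈ c.flatMap Instr.operands → x i = y i) :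
    runFrom x rs c = runFrom y rs c := by
  induction c generalizing rs with
  | nil => rfl
  | cons a c ih =>
    have hop : ∀ p ∈ a.operands, p.eval x rs = p.eval y rs := by
      intro p hp
      cases p with
      | const c => rfl
      | input i => exact h i (List.mem_flatMap.2 ⟨a, by simp, hp⟩)
      | reg j => rfl
    have ha : a.eval x rs = a.eval y rs := by
      cases a with
      | add p q =>
        simp only [Instr.operands, List.mem_cons, List.not_mem_nil, or_false, forall_eq_or_imp,
          forall_eq] at hop
        simp only [Instr.eval, hop]
      | mul p q =>
        simp only [Instr.operands, List.mem_cons, List.not_mem_nil, or_false, forall_eq_or_imp,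
          forall_eq] at hop
        simp only [Instr.eval, hop]
    have := ih (rs ++ [a.eval x rs]) fun i hi => h i (by
      rw [List.flatMap_cons]; exact List.mem_append_right _ hi)
    simp only [runFrom, List.foldl_cons] at this ⊢
    rw [this, ha]

lemma length_operands {S ι : Type*} (c : List (Instr S ι)) :
    (c.flatMap Instr.operands).length = 2 * c.length := by
  induction c with
  | nil => rfl
  | cons a c ih =>
    rw [List.flatMap_cons, List.length_append, ih, List.length_cons]
    cases a <;> simp [Instr.operands] <;> ring

/-- All outputs are registers, so they depend only on inputs that occur as operands in the code.
Every input does influence some entry, and an instruction has just two operands. The indices `i₀`,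
`j₀` guarantee an entry in which the influence is seen. -/
lemma MatProgram.Correct.card_inputs_le [Fintype α] [Fintype β] [Nontrivial R]
    {P : MatProgram R α β γ} (hP : P.Correct) (i₀ : α) (j₀ : β) :
    Fintype.card ((α × γ) ⊕ (γ × β)) ≤ 2 * SLP.size P := by
  classical
  have key : ∀ x y : (α × γ) ⊕ (γ × β) → R, ∀ p,
      (∀ q, Operand.input q ∈ P.code.flatMap Instr.operands → x q = y q) → α × β → γ →
      SLP.eval P x p = SLP.eval P y p := by
    intro x y p hxy _ k
    obtain ⟨r, -, hr⟩ := hP.exists_out_eq_reg k p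
    have := runFrom_congr P.code [] hxy
    simp only [SLP.eval, hr, Operand.eval]
    exact congrArg (fun l => l.getD r 0) this
  have hmem : ∀ q, Operand.input q ∈ P.code.flatMap Instr.operands := by
    intro q
    by_contra hq
    rcases q with ⟨i, k⟩ | ⟨k, j⟩
    · have h1 := hP.eval_single i i j₀ j₀ k 1
      have h0 := hP.eval_single i i j₀ j₀ k 0
      rw [key _ _ _ _ (i₀, j₀) k, h0] at h1
      · simp at h1
      · rintro (⟨i', k'⟩ | ⟨k', j'⟩) hq'
        · have : ¬ (i = i' ∧ k = k') := by
            rintro ⟨rfl, rfl⟩; exact hq hq'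
          simp [Matrix.single_apply, this]
        · rfl
    · have h1 := hP (Matrix.single i₀ k 1) (Matrix.single k j 1) i₀ j
      have h0 := hP (Matrix.single i₀ k 1) (Matrix.single k j 0) i₀ j
      rw [key _ _ _ _ (i₀, j₀) k, h0] at h1
      · simp at h1
      · rintro (⟨i', k'⟩ | ⟨k', j'⟩) hq'
        · rfl
        · have : ¬ (k = k' ∧ j = j') := by
            rintro ⟨rfl, rfl⟩; exact hq hq'
          simp [Matrix.single_apply, this]
  have hinj : Function.Injective (Operand.input : _ → Operand R ((α × γ) ⊕ (γ × β))) :=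
    fun a b h => by injection h
  calc Fintype.card ((α × γ) ⊕ (γ × β))
      = (Finset.univ.map ⟨_, hinj⟩).card := by simp
    _ ≤ (P.code.flatMap Instr.operands).toFinset.card :=
        Finset.card_le_card fun p hp => by
          obtain ⟨q, -, rfl⟩ := Finset.mem_map.1 hp
          exact List.mem_toFinset.2 (hmem q)
    _ ≤ (P.code.flatMap Instr.operands).length := List.toFinset_card_le _
    _ = 2 * SLP.size P := length_operands _

end LowerBounds

variable (R) [Nontrivial R]

lemma sq_le_mulCost {N c : ℕ} (hc : 0 < c) : N * N ≤ mulCost R N c N := by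
  obtain ⟨P, hP, hm⟩ := mulIn_mulCost R N c N
  have := hP.card_mul_card_le ⟨0, hc⟩
  simp only [Fintype.card_fin] at this
  exact this.trans hm

lemma mul_le_mulCost {N c : ℕ} : N * c ≤ mulCost R N c N := by
  rcases Nat.eq_zero_or_pos N with rfl | hN
  · simp
  obtain ⟨P, hP, hm⟩ := mulIn_mulCost R N c N
  have := hP.card_inputs_le ⟨0, hN⟩ ⟨0, hN⟩
  simp only [Fintype.card_sum, Fintype.card_prod, Fintype.card_fin] at this
  rw [mul_comm c N] at this
  omega

end MatrixPrograms

/-! ### The exponent of rectangular matrix multiplication -/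

section Omega

variable (R : Type v) [CommRing R]

/-- The set whose infimum is `omega R k`. -/
def exponents (k : ℝ) : Set ℝ :=
  {w : ℝ | ∀ ε : ℝ, 0 < ε →
    (fun N : ℕ => (mulCost R N ⌈(N : ℝ) ^ k⌉₊ N : ℝ)) =O[atTop] fun N : ℕ => (N : ℝ) ^ (w + ε)}

lemma ceil_le_two_mul {x : ℝ} (hx : 1 ≤ x) : (⌈x⌉₊ : ℝ) ≤ 2 * x := by
  have := Nat.ceil_lt_add_one (zero_le_one.trans hx)
  linarith

lemma isBigO_of_le {f : ℕ → ℝ} {C e : ℝ} (hf : ∀ N, 0 ≤ f N)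
    (h : ∀ N : ℕ, 1 ≤ N → f N ≤ C * (N : ℝ) ^ e) : f =O[atTop] fun N : ℕ => (N : ℝ) ^ e := by
  refine IsBigO.of_bound C ?_
  filter_upwards [eventually_ge_atTop 1] with N hN
  rw [Real.norm_of_nonneg (hf N), Real.norm_of_nonneg (by positivity)]
  exact h N hN

/-- Along `ℕ`, finitely many exceptions to a big-O bound can be absorbed by the constant, as `N ^ e`
does not vanish for `N ≥ 1`. -/
lemma exists_bound_of_isBigO {f : ℕ → ℝ} {e : ℝ} (h : f =O[atTop] fun N : ℕ => (N : ℝ) ^ e) :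
    ∃ C > 0, ∀ N : ℕ, 1 ≤ N → f N ≤ C * (N : ℝ) ^ e := by
  obtain ⟨C, hC, hb⟩ := bound_of_isBigO_nat_atTop h
  refine ⟨C, hC, fun N hN => ?_⟩
  have hpos : 0 < (N : ℝ) ^ e := Real.rpow_pos_of_pos (by exact_mod_cast hN) e
  have := hb hpos.ne'
  rw [Real.norm_of_nonneg hpos.le] at this
  exact (le_abs_self _).trans this

lemma le_of_rpow_le {e w C : ℝ} (h : ∀ N : ℕ, 1 ≤ N → (N : ℝ) ^ e ≤ C * (N : ℝ) ^ w) :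
    e ≤ w := by
  by_contra! hlt
  have ht : Tendsto (fun N : ℕ => (N : ℝ) ^ (e - w)) atTop atTop :=
    (tendsto_rpow_atTop (sub_pos.2 hlt)).comp tendsto_natCast_atTop_atTop
  obtain ⟨N, hN, h1⟩ := ((ht.eventually_gt_atTop C).and (eventually_ge_atTop 1)).exists
  have hpos : (0 : ℝ) < N := by exact_mod_cast h1
  have := h N h1
  rw [Real.rpow_sub hpos, lt_div_iff₀ (Real.rpow_pos_of_pos hpos w)] at hN
  linarith

lemma two_add_mem_exponents {k : ℝ} (hk : 0 ≤ k) : 2 + k ∈ exponents R k := by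
  intro ε hε
  -- One factor `2` counts additions and multiplications of the school method, the other pays for
  -- the ceiling.
  refine isBigO_of_le (C := 4) (fun N => Nat.cast_nonneg _) fun N hN => ?_
  have hN1 : (1 : ℝ) ≤ N := by exact_mod_cast hN
  have hpos : (0 : ℝ) < N := by linarith
  have h1 : (mulCost R N ⌈(N : ℝ) ^ k⌉₊ N : ℝ) ≤ N * N * ⌈(N : ℝ) ^ k⌉₊ * 2 := by
    exact_mod_cast mulCost_le_naive R N N _
  have h2 := ceil_le_two_mul (Real.one_le_rpow hN1 hk)
  calc (mulCost R N ⌈(N : ℝ) ^ k⌉₊ N : ℝ) ≤ N * N * ⌈(N : ℝ) ^ k⌉₊ * 2 := h1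
    _ ≤ N * N * (2 * (N : ℝ) ^ k) * 2 := by gcongr
    _ = 4 * (N : ℝ) ^ (2 + k) := by
        rw [Real.rpow_add hpos, Real.rpow_two]; ring
    _ ≤ 4 * (N : ℝ) ^ (2 + k + ε) := by
        gcongr 4 * ?_
        exact Real.rpow_le_rpow_of_exponent_le hN1 (by linarith)

lemma exists_mulCost_le {k : ℝ} (hk : 0 ≤ k) {ε : ℝ} (hε : 0 < ε) :
    ∃ C > 0, ∀ N : ℕ, 1 ≤ N →
      (mulCost R N ⌈(N : ℝ) ^ k⌉₊ N : ℝ) ≤ C * (N : ℝ) ^ (omega R k + ε) := by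
  obtain ⟨w, hw, hlt⟩ := exists_lt_of_csInf_lt (s := exponents R k)
    ⟨_, two_add_mem_exponents R hk⟩ (lt_add_of_pos_right (omega R k) (half_pos hε))
  obtain ⟨C, hC, hb⟩ := exists_bound_of_isBigO (hw (ε / 2) (half_pos hε))
  refine ⟨C, hC, fun N hN => (hb N hN).trans ?_⟩
  gcongr C * ?_
  exact Real.rpow_le_rpow_of_exponent_le (by exact_mod_cast hN) (by linarith)

variable [Nontrivial R]

lemma two_le_of_mem_exponents {k w : ℝ} (h : w ∈ exponents R k) : 2 ≤ w := by
  refine le_of_forall_pos_le_add fun ε hε => ?_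
  obtain ⟨C, -, hb⟩ := exists_bound_of_isBigO (h ε hε)
  refine le_of_rpow_le fun N hN => le_trans ?_ (hb N hN)
  have hpos : (0 : ℝ) < N := by exact_mod_cast hN
  rw [Real.rpow_two, sq]
  exact_mod_cast sq_le_mulCost R (Nat.ceil_pos.2 (Real.rpow_pos_of_pos hpos k))

lemma one_add_le_of_mem_exponents {k w : ℝ} (h : w ∈ exponents R k) : 1 + k ≤ w := by
  refine le_of_forall_pos_le_add fun ε hε => ?_
  obtain ⟨C, -, hb⟩ := exists_bound_of_isBigO (h ε hε)
  refine le_of_rpow_le fun N hN => le_trans ?_ (hb N hN)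
  have hpos : (0 : ℝ) < N := by exact_mod_cast hN
  rw [Real.rpow_add hpos, Real.rpow_one]
  calc (N : ℝ) * (N : ℝ) ^ k ≤ N * ⌈(N : ℝ) ^ k⌉₊ := by gcongr; exact Nat.le_ceil _
    _ ≤ _ := by exact_mod_cast mul_le_mulCost R

lemma bddBelow_exponents (k : ℝ) : BddBelow (exponents R k) :=
  ⟨2, fun _ h => two_le_of_mem_exponents R h⟩

lemma two_le_omega {k : ℝ} (hk : 0 ≤ k) : 2 ≤ omega R k :=
  le_csInf ⟨_, two_add_mem_exponents R hk⟩ fun _ h => two_le_of_mem_exponents R h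

lemma one_add_le_omega {k : ℝ} (hk : 0 ≤ k) : 1 + k ≤ omega R k :=
  le_csInf ⟨_, two_add_mem_exponents R hk⟩ fun _ h => one_add_le_of_mem_exponents R h

lemma omega_le_two_add {k : ℝ} (hk : 0 ≤ k) : omega R k ≤ 2 + k :=
  csInf_le (bddBelow_exponents R k) (two_add_mem_exponents R hk)

lemma omega_mono {k l : ℝ} (hk : 0 ≤ k) (hkl : k ≤ l) : omega R k ≤ omega R l := by
  refine csInf_le_csInf (bddBelow_exponents R k) ⟨_, two_add_mem_exponents R (hk.trans hkl)⟩
    fun w hw ε hε => ?_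
  obtain ⟨C, -, hb⟩ := exists_bound_of_isBigO (hw ε hε)
  refine isBigO_of_le (C := C) (fun N => Nat.cast_nonneg _) fun N hN => le_trans ?_ (hb N hN)
  have hN1 : (1 : ℝ) ≤ N := by exact_mod_cast hN
  exact_mod_cast mulCost_mono R le_rfl le_rfl
    (Nat.ceil_mono (Real.rpow_le_rpow_of_exponent_le hN1 hkl))

/-- Cutting the inner dimension into `⌈N ^ δ⌉₊` slices reduces the product to that many products
with inner dimension `⌈N ^ k⌉₊`. The `N * N` additions per slice are dominated by the product itself
(`sq_le_mulCost`). -/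
lemma omega_add_le {k δ : ℝ} (hk : 0 ≤ k) (hδ : 0 ≤ δ) : omega R (k + δ) ≤ omega R k + δ := by
  refine csInf_le (bddBelow_exponents R _) fun ε hε => ?_
  obtain ⟨C, hC, hb⟩ := exists_mulCost_le R hk hε
  refine isBigO_of_le (C := 4 * C) (fun N => Nat.cast_nonneg _) fun N hN => ?_
  have hN1 : (1 : ℝ) ≤ N := by exact_mod_cast hN
  have hpos : (0 : ℝ) < N := by linarith
  set c := ⌈(N : ℝ) ^ k⌉₊
  have hc : 0 < c := Nat.ceil_pos.2 (Real.rpow_pos_of_pos hpos k)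
  have h1 : ⌈(N : ℝ) ^ (k + δ)⌉₊ ≤ ⌈(N : ℝ) ^ δ⌉₊ * c := by
    rw [Nat.ceil_le, add_comm, Real.rpow_add hpos]
    push_cast
    gcongr <;> exact Nat.le_ceil _
  have h2 : mulCost R N ⌈(N : ℝ) ^ (k + δ)⌉₊ N ≤ ⌈(N : ℝ) ^ δ⌉₊ * (2 * mulCost R N c N) := by
    have h3 := mulCost_mul_le R 1 1 ⌈(N : ℝ) ^ δ⌉₊ N N c
    simp only [one_mul] at h3
    refine (mulCost_mono R le_rfl le_rfl h1).trans (h3.trans ?_)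
    have := sq_le_mulCost R (N := N) hc
    gcongr
    omega
  calc (mulCost R N ⌈(N : ℝ) ^ (k + δ)⌉₊ N : ℝ)
      ≤ ⌈(N : ℝ) ^ δ⌉₊ * (2 * mulCost R N c N) := by exact_mod_cast h2
    _ ≤ (2 * (N : ℝ) ^ δ) * (2 * (C * (N : ℝ) ^ (omega R k + ε))) := by
        gcongr
        · exact ceil_le_two_mul (Real.one_le_rpow hN1 hδ)
        · exact hb N hN
    _ = 4 * C * (N : ℝ) ^ (omega R k + δ + ε) := by
        rw [add_right_comm, Real.rpow_add hpos _ δ]; ring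

lemma continuousOn_omega : ContinuousOn (omega R) (Set.Ici 0) := by
  have : LipschitzOnWith 1 (omega R) (Set.Ici 0) := by
    refine LipschitzOnWith.of_le_add fun x hx y hy => ?_
    rcases le_total x y with h | h
    · exact (omega_mono R hx h).trans (le_add_of_nonneg_right dist_nonneg)
    · have := omega_add_le R hy (sub_nonneg.2 h)
      rw [add_sub_cancel] at this
      rwa [Real.dist_eq, abs_of_nonneg (sub_nonneg.2 h)]
  exact this.continuousOn

lemma mulTerm_le {a b : ℝ} (ha : 0 ≤ a) (hb : 0 ≤ b) : mulTerm R a b ≤ a := by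
  unfold mulTerm
  split_ifs with h
  · exact le_rfl
  · have hb' : 0 < b := lt_of_le_of_ne hb (Ne.symm h)
    calc b * (omega R (a / b) - 2) ≤ b * (a / b) := by
          gcongr
          linarith [omega_le_two_add R (div_nonneg ha hb)]
      _ = a := mul_div_cancel₀ a h

/-- Reading the inputs forces `1 + k ≤ ω(k)`. Together with `mulTerm_le` this squeezes `mulTerm` as
`b → 0`. -/
lemma sub_le_mulTerm {a b : ℝ} (ha : 0 ≤ a) (hb : 0 ≤ b) : a - b ≤ mulTerm R a b := by
  unfold mulTerm
  split_ifs with h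
  · linarith
  · calc a - b = b * (a / b - 1) := by rw [mul_sub, mul_div_cancel₀ a h, mul_one]
      _ ≤ b * (omega R (a / b) - 2) := by
          gcongr b * ?_
          linarith [one_add_le_omega R (div_nonneg ha hb)]

lemma mulTerm_nonneg {a b : ℝ} (ha : 0 ≤ a) (hb : 0 ≤ b) : 0 ≤ mulTerm R a b := by
  unfold mulTerm
  split_ifs with h
  · exact ha
  · exact mul_nonneg hb (sub_nonneg.2 (two_le_omega R (div_nonneg ha hb)))

/-- A bound for the cost of balanced products that is uniform in their shape. -/
lemma exists_mulCost_square_le {ε : ℝ} (hε : 0 < ε) :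
    ∃ C > 0, ∀ t a b : ℝ, 0 ≤ t → 0 ≤ a → a ≤ 2 → 0 ≤ b → b ≤ 1 → ∀ c : ℕ,
      (c : ℝ) ≤ 2 ^ (a * t) →
      (mulCost R ⌈(2 : ℝ) ^ (b * t)⌉₊ c ⌈(2 : ℝ) ^ (b * t)⌉₊ : ℝ) ≤
        C * 2 ^ ((2 * b + mulTerm R a b + ε) * t) := by
  -- For `b > ε` the ratio `a / b` is at most `2 / ε`, so the finitely many grid points `j * δ` with
  -- `j ≤ J` suffice and `D` bounds their constants. Rounding a ratio up to the grid raises `omega`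
  -- by at most `δ`.
  set δ := ε / 2 with hδ
  have hδ0 : 0 < δ := half_pos hε
  choose C hC0 hC using fun j : ℕ =>
    exists_mulCost_le R (k := j * δ) (by positivity) hδ0
  set J := ⌈2 / ε / δ⌉₊
  obtain ⟨D, hD⟩ := (Finset.image C (Finset.range (J + 1))).exists_le
  have hD' : ∀ j ≤ J, C j ≤ D := fun j hj =>
    hD _ (Finset.mem_image_of_mem _ (Finset.mem_range.2 (by omega)))
  have hD0 : 0 < D := (hC0 0).trans_le (hD' 0 (Nat.zero_le _))
  -- This pays for `N ≤ 2 * 2 ^ (b * t)`, raised to a power of at most `omega R (a / b) + ε ≤ 2 + 2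
  -- / ε + ε`.
  set E : ℝ := 2 ^ (2 + 2 / ε + ε)
  have hE : 0 < E := by positivity
  refine ⟨8 + D * E, by positivity, fun t a b ht ha ha2 hb hb1 c hc => ?_⟩
  set N := ⌈(2 : ℝ) ^ (b * t)⌉₊
  have h2bt : (1 : ℝ) ≤ 2 ^ (b * t) := Real.one_le_rpow one_le_two (by positivity)
  have hN2 : (N : ℝ) ≤ 2 * 2 ^ (b * t) := ceil_le_two_mul h2bt
  have hNle : (2 : ℝ) ^ (b * t) ≤ N := Nat.le_ceil _
  have hN1 : (1 : ℝ) ≤ N := h2bt.trans hNle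
  by_cases hlarge : b ≤ ε
  -- The school method has the exponent `2 * b + a`, and `a ≤ mulTerm R a b + b ≤ mulTerm R a b +
  -- ε`.
  · have h1 : (mulCost R N c N : ℝ) ≤ N * N * c * 2 := by
      exact_mod_cast mulCost_le_naive R N N c
    calc (mulCost R N c N : ℝ) ≤ N * N * c * 2 := h1
      _ ≤ (2 * 2 ^ (b * t)) * (2 * 2 ^ (b * t)) * 2 ^ (a * t) * 2 := by gcongr
      _ = 8 * 2 ^ ((2 * b + a) * t) := by
          rw [show (2 * b + a) * t = b * t + b * t + a * t by ring,
            Real.rpow_add two_pos, Real.rpow_add two_pos]; ring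
      _ ≤ (8 + D * E) * 2 ^ ((2 * b + mulTerm R a b + ε) * t) := by
          gcongr ?_ * ?_
          · have : 0 < D * E := by positivity
            linarith
          · refine Real.rpow_le_rpow_of_exponent_le one_le_two ?_
            refine mul_le_mul_of_nonneg_right ?_ ht
            linarith [sub_le_mulTerm R ha hb]
  · push Not at hlarge
    have hb0 : 0 < b := hε.trans hlarge
    have hk0 : 0 ≤ a / b := by positivity
    have hkK : a / b ≤ 2 / ε := by gcongr
    set j := ⌈a / b / δ⌉₊
    have hjJ : j ≤ J := Nat.ceil_mono (by gcongr)
    have hj1 : a / b ≤ j * δ := (div_le_iff₀ hδ0).1 (Nat.le_ceil _)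
    have hj2 : j * δ ≤ a / b + δ := by
      have := (Nat.ceil_lt_add_one (div_nonneg hk0 hδ0.le)).le
      calc j * δ ≤ (a / b / δ + 1) * δ := by gcongr
        _ = a / b + δ := by field_simp
    have hw : omega R (j * δ) + δ ≤ omega R (a / b) + ε := by
      have h1 := omega_mono R (by positivity) hj2
      have h2 := omega_add_le R hk0 hδ0.le
      linarith
    have hcN : c ≤ ⌈(N : ℝ) ^ (j * δ)⌉₊ := by
      have : (c : ℝ) ≤ (N : ℝ) ^ (j * δ) := by
        calc (c : ℝ) ≤ 2 ^ (a * t) := hc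
          _ = (2 ^ (b * t)) ^ (a / b) := by
              rw [← Real.rpow_mul zero_le_two]; congr 1; field_simp
          _ ≤ (N : ℝ) ^ (a / b) := by gcongr
          _ ≤ (N : ℝ) ^ (j * δ) := by gcongr
      exact_mod_cast this.trans (Nat.le_ceil _)
    have hmono : (mulCost R N c N : ℝ) ≤ mulCost R N ⌈(N : ℝ) ^ (j * δ)⌉₊ N := by
      exact_mod_cast mulCost_mono R le_rfl le_rfl hcN
    have hwpos : 0 ≤ omega R (a / b) + ε := by linarith [two_le_omega R hk0]
    calc (mulCost R N c N : ℝ) ≤ mulCost R N ⌈(N : ℝ) ^ (j * δ)⌉₊ N := hmono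
      _ ≤ C j * (N : ℝ) ^ (omega R (j * δ) + δ) := hC j N (by exact_mod_cast hN1)
      _ ≤ D * (N : ℝ) ^ (omega R (a / b) + ε) := by
          gcongr
          exact hD' j hjJ
      _ ≤ D * (2 * 2 ^ (b * t)) ^ (omega R (a / b) + ε) := by gcongr
      _ = D * (2 ^ (omega R (a / b) + ε) * 2 ^ (b * t * (omega R (a / b) + ε))) := by
          rw [Real.mul_rpow zero_le_two (by positivity), ← Real.rpow_mul zero_le_two]
      _ ≤ D * (E * 2 ^ ((2 * b + mulTerm R a b + ε) * t)) := by
          gcongr ?_ * (?_ * ?_)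
          · refine Real.rpow_le_rpow_of_exponent_le one_le_two ?_
            linarith [omega_le_two_add R hk0]
          · refine Real.rpow_le_rpow_of_exponent_le one_le_two ?_
            rw [mulTerm, if_neg hb0.ne']
            have : b * ε ≤ 1 * ε := by gcongr
            calc b * t * (omega R (a / b) + ε) = (b * omega R (a / b) + b * ε) * t := by ring
              _ ≤ (2 * b + b * (omega R (a / b) - 2) + ε) * t := by
                  refine mul_le_mul_of_nonneg_right ?_ ht
                  linarith
      _ ≤ (8 + D * E) * 2 ^ ((2 * b + mulTerm R a b + ε) * t) := by
          rw [← mul_assoc]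
          gcongr
          linarith

/-- A bound for the cost of products that is uniform in their shape. -/
lemma exists_mulCost_rect_le {ε : ℝ} (hε : 0 < ε) :
    ∃ C > 0, ∀ t a b₁ b₂ : ℝ, 0 ≤ t → 0 ≤ a → a ≤ 2 → 0 ≤ b₁ → b₁ ≤ 1 → 0 ≤ b₂ → b₂ ≤ 1 →
      ∀ M₁ c M₂ : ℕ, (c : ℝ) ≤ 2 ^ (a * t) → (M₁ : ℝ) ≤ 2 ^ (b₁ * t) →
      (M₂ : ℝ) ≤ 2 ^ (b₂ * t) →
      (mulCost R M₁ c M₂ : ℝ) ≤ C * 2 ^ ((b₁ + b₂ + mulTerm R a (min b₁ b₂) + ε) * t) := by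
  obtain ⟨C, hC, hb⟩ := exists_mulCost_square_le R hε
  refine ⟨4 * (C + 4), by positivity,
    fun t a b₁ b₂ ht ha ha2 hb₁ hb₁' hb₂ hb₂' M₁ c M₂ hc hM₁ hM₂ => ?_⟩
  set b := min b₁ b₂
  have hb0 : 0 ≤ b := le_min hb₁ hb₂
  have hb1 : b ≤ 1 := (min_le_left _ _).trans hb₁'
  set N := ⌈(2 : ℝ) ^ (b * t)⌉₊
  have h2bt : (1 : ℝ) ≤ 2 ^ (b * t) := Real.one_le_rpow one_le_two (by positivity)
  have hN2 : (N : ℝ) ≤ 2 * 2 ^ (b * t) := ceil_le_two_mul h2bt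
  have hNle : (2 : ℝ) ^ (b * t) ≤ N := Nat.le_ceil _
  have split : ∀ (d : ℝ), b ≤ d → ∀ M : ℕ, (M : ℝ) ≤ 2 ^ (d * t) →
      M ≤ ⌈(2 : ℝ) ^ ((d - b) * t)⌉₊ * N ∧
        (⌈(2 : ℝ) ^ ((d - b) * t)⌉₊ : ℝ) ≤ 2 * 2 ^ ((d - b) * t) := by
    intro d hd M hM
    refine ⟨?_, ceil_le_two_mul (Real.one_le_rpow one_le_two
      (mul_nonneg (sub_nonneg.2 hd) ht))⟩
    have : (M : ℝ) ≤ ⌈(2 : ℝ) ^ ((d - b) * t)⌉₊ * N := by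
      calc (M : ℝ) ≤ 2 ^ (d * t) := hM
        _ = 2 ^ ((d - b) * t) * 2 ^ (b * t) := by
            rw [← Real.rpow_add two_pos]; congr 1; ring
        _ ≤ _ := by gcongr; exact Nat.le_ceil _
    exact_mod_cast this
  obtain ⟨h1, h1'⟩ := split b₁ (min_le_left _ _) M₁ hM₁
  obtain ⟨h2, h2'⟩ := split b₂ (min_le_right _ _) M₂ hM₂
  set q₁ := ⌈(2 : ℝ) ^ ((b₁ - b) * t)⌉₊
  set q₂ := ⌈(2 : ℝ) ^ ((b₂ - b) * t)⌉₊
  -- The rows of the first factor and the columns of the second are cut into groups of `N`; the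
  -- inner dimension stays whole.
  have h3 := mulCost_mul_le R q₁ q₂ 1 N N c
  rw [one_mul, mul_one] at h3
  have h4 := (mulCost_mono R h1 h2 le_rfl).trans h3
  have hsq : (N : ℝ) * N ≤ 4 * 2 ^ ((2 * b + mulTerm R a b + ε) * t) := by
    calc (N : ℝ) * N ≤ (2 * 2 ^ (b * t)) * (2 * 2 ^ (b * t)) := by gcongr
      _ = 4 * 2 ^ (2 * b * t) := by
          rw [show 2 * b * t = b * t + b * t by ring, Real.rpow_add two_pos]; ring
      _ ≤ _ := by
          gcongr
          · exact one_le_two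
          · linarith [mulTerm_nonneg R ha hb0]
  calc (mulCost R M₁ c M₂ : ℝ) ≤ q₁ * q₂ * (mulCost R N c N + N * N) := by exact_mod_cast h4
    _ ≤ (2 * 2 ^ ((b₁ - b) * t)) * (2 * 2 ^ ((b₂ - b) * t)) *
        (C * 2 ^ ((2 * b + mulTerm R a b + ε) * t) +
          4 * 2 ^ ((2 * b + mulTerm R a b + ε) * t)) := by
        gcongr
        exact hb t a b ht ha ha2 hb0 hb1 c hc
    _ = 4 * (C + 4) * 2 ^ ((b₁ + b₂ + mulTerm R a b + ε) * t) := by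
        rw [show (b₁ + b₂ + mulTerm R a b + ε) * t =
          (b₁ - b) * t + (b₂ - b) * t + (2 * b + mulTerm R a b + ε) * t by ring,
          Real.rpow_add two_pos, Real.rpow_add two_pos]
        ring

end Omega

/-! ### Continuity of the exponent -/

section Exponent

lemma log_two_pos : 0 < Real.log 2 := Real.log_pos one_lt_two

lemma H_nonneg {x : ℝ} (h0 : 0 ≤ x) (h1 : x ≤ 1) : 0 ≤ H x :=
  div_nonneg (Real.binEntropy_nonneg h0 h1) log_two_pos.le

lemma H_le_one (x : ℝ) : H x ≤ 1 :=
  (div_le_one log_two_pos).2 Real.binEntropy_le_log_two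

lemma continuous_H : Continuous H := Real.binEntropy_continuous.div_const _

lemma H_half : H (1 / 2) = 1 := by
  rw [H, one_div, Real.binEntropy_two_inv, div_self log_two_pos.ne']

lemma div_mem_unit {σ κ : ℝ} (h0 : 0 ≤ σ) (h1 : σ ≤ κ) : 0 ≤ σ / κ ∧ σ / κ ≤ 1 :=
  ⟨div_nonneg h0 (h0.trans h1), div_le_one_of_le₀ h1 (h0.trans h1)⟩

/-- The homogeneous form has no quotient, so it is visibly continuous also at `κ = 0`. -/
lemma alpha_eq {σ κ : ℝ} (h0 : 0 ≤ σ) (h1 : σ ≤ κ) :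
    alpha σ κ =
      (Real.negMulLog σ + Real.negMulLog (κ - σ) - Real.negMulLog κ) / Real.log 2 := by
  rcases (h0.trans h1).eq_or_lt with rfl | hκ
  · obtain rfl : σ = 0 := le_antisymm h1 h0
    simp [alpha]
  rw [alpha, H, Real.binEntropy_eq_negMulLog_add_negMulLog_one_sub, ← mul_div_assoc]
  congr 1
  have e1 : σ = κ * (σ / κ) := by field_simp
  have e2 : κ - σ = κ * (1 - σ / κ) := by field_simp
  have h2 := Real.negMulLog_mul κ (σ / κ)
  have h3 := Real.negMulLog_mul κ (1 - σ / κ)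
  rw [← e1] at h2
  rw [← e2] at h3
  rw [h2, h3]
  ring

lemma alpha_nonneg {σ κ : ℝ} (h0 : 0 ≤ σ) (h1 : σ ≤ κ) : 0 ≤ alpha σ κ :=
  mul_nonneg (h0.trans h1) (H_nonneg (div_mem_unit h0 h1).1 (div_mem_unit h0 h1).2)

lemma alpha_le {σ κ : ℝ} (hκ : 0 ≤ κ) : alpha σ κ ≤ κ :=
  mul_le_of_le_one_right hκ (H_le_one _)

/-- This reduces bounds and continuity of `beta` to those of `alpha`. -/
lemma beta_eq {σ κ : ℝ} (h : 0 ≤ κ) : beta σ κ = 1 - κ + alpha (max σ (κ / 2)) κ := by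
  rcases h.eq_or_lt with rfl | hκ
  · simp [beta, alpha]
  · rw [beta, alpha, ← max_div_div_right hκ.le, div_right_comm, div_self hκ.ne']

lemma beta_nonneg {σ κ : ℝ} (h0 : 0 ≤ σ) (h1 : σ ≤ κ) (h2 : κ ≤ 1) : 0 ≤ beta σ κ := by
  rw [beta_eq (h0.trans h1)]
  have := alpha_nonneg (σ := max σ (κ / 2)) (κ := κ) (h0.trans (le_max_left _ _))
    (max_le h1 (by linarith))
  linarith

lemma beta_le_one {σ κ : ℝ} (h : 0 ≤ κ) : beta σ κ ≤ 1 := by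
  rw [beta_eq h]
  linarith [alpha_le (σ := max σ (κ / 2)) h]

lemma continuousOn_alpha :
    ContinuousOn (fun p : ℝ × ℝ => alpha p.1 p.2) {p | 0 ≤ p.1 ∧ p.1 ≤ p.2} := by
  have : Continuous fun p : ℝ × ℝ =>
      (Real.negMulLog p.1 + Real.negMulLog (p.2 - p.1) - Real.negMulLog p.2) / Real.log 2 := by
    have h := Real.continuous_negMulLog
    exact (((h.comp continuous_fst).add (h.comp (continuous_snd.sub continuous_fst))).sub
      (h.comp continuous_snd)).div_const _
  exact this.continuousOn.congr fun p hp => alpha_eq hp.1 hp.2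

lemma continuousOn_beta :
    ContinuousOn (fun p : ℝ × ℝ => beta p.1 p.2) {p | 0 ≤ p.1 ∧ p.1 ≤ p.2} := by
  have h1 : ContinuousOn (fun p : ℝ × ℝ => alpha (max p.1 (p.2 / 2)) p.2)
      {p | 0 ≤ p.1 ∧ p.1 ≤ p.2} := by
    refine continuousOn_alpha.comp (f := fun p : ℝ × ℝ => (max p.1 (p.2 / 2), p.2))
      (Continuous.continuousOn (by fun_prop)) ?_
    rintro ⟨σ, κ⟩ ⟨h0, h1⟩
    exact ⟨le_max_of_le_left h0, max_le h1 (by simp only at h0 h1 ⊢; linarith)⟩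
  have h2 : ContinuousOn (fun p : ℝ × ℝ => 1 - p.2) {p | 0 ≤ p.1 ∧ p.1 ≤ p.2} :=
    Continuous.continuousOn (by fun_prop)
  exact (h2.add h1).congr fun p hp => beta_eq (hp.1.trans hp.2)

/-! ### Existence of the max-min -/

variable (R : Type v) [CommRing R]

/-- The point of `[σ, 1]` that divides the interval in the ratio `t : 1 - t`. -/
def between (σ t : unitInterval) : ℝ := σ + t * (1 - σ)

lemma between_mem (σ t : unitInterval) : between σ t ∈ Set.Icc (σ : ℝ) 1 := by
  have h0 := σ.2.1
  have h1 := σ.2.2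
  have h2 := t.2.1
  have h3 := t.2.2
  constructor <;> rw [between] <;> nlinarith

lemma exists_between_eq (σ : unitInterval) {κ : ℝ} (h : κ ∈ Set.Icc (σ : ℝ) 1) :
    ∃ t, between σ t = κ := by
  rcases σ.2.2.eq_or_lt with h1 | h1
  · refine ⟨0, ?_⟩
    have := h.1
    have := h.2
    simp only [between, Set.Icc.coe_zero]
    linarith
  · have h2 : 0 < 1 - (σ : ℝ) := sub_pos.2 h1
    refine ⟨⟨(κ - σ) / (1 - σ), div_nonneg (sub_nonneg.2 h.1) h2.le, ?_⟩, ?_⟩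
    · rw [div_le_one h2]
      linarith [h.2]
    · simp only [between]
      rw [div_mul_cancel₀ _ h2.ne']
      ring

/-- The exponent as a function on two compact squares. -/
noncomputable def gamSquare (s t : unitInterval × unitInterval) : ℝ :=
  Gam R s.1 s.2 (between s.1 t.1) (between s.2 t.2)

/-- The domain `[σ₁, 1] × [σ₂, 1]` moves with `σ`. The parametrisation by `between` replaces it by a
fixed compact square, over which the infimum of a continuous function depends continuously on the
parameter. -/
lemma isMinOverKappa_iff (s : unitInterval × unitInterval) (m : ℝ) :
    IsMinOverKappa R s.1 s.2 m ↔ IsLeast (Set.range (gamSquare R s)) m := by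
  have : {x | ∃ κ₁ ∈ Set.Icc (s.1 : ℝ) 1, ∃ κ₂ ∈ Set.Icc (s.2 : ℝ) 1, x = Gam R s.1 s.2 κ₁ κ₂} =
      Set.range (gamSquare R s) := by
    ext x
    constructor
    · rintro ⟨κ₁, h1, κ₂, h2, rfl⟩
      obtain ⟨t₁, rfl⟩ := exists_between_eq _ h1
      obtain ⟨t₂, rfl⟩ := exists_between_eq _ h2
      exact ⟨(t₁, t₂), rfl⟩
    · rintro ⟨t, rfl⟩
      exact ⟨_, between_mem _ _, _, between_mem _ _, rfl⟩
  rw [IsMinOverKappa, this]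

variable [Nontrivial R]

/-- At `b = 0` the bounds `a - b` and `a` squeeze the function; for `b > 0` continuity comes from
that of `omega`. -/
lemma continuousOn_mulTerm :
    ContinuousOn (fun p : ℝ × ℝ => mulTerm R p.1 p.2) {p | 0 ≤ p.1 ∧ 0 ≤ p.2} := by
  rintro ⟨a, b⟩ ⟨ha : 0 ≤ a, hb : 0 ≤ b⟩
  rcases hb.eq_or_lt with rfl | hb
  · have h1 : Tendsto (fun p : ℝ × ℝ => p.1) (nhdsWithin (a, 0) {p | 0 ≤ p.1 ∧ 0 ≤ p.2})
        (nhds a) := (continuous_fst.tendsto (a, (0 : ℝ))).mono_left nhdsWithin_le_nhds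
    have h2 : Tendsto (fun p : ℝ × ℝ => p.1 - p.2)
        (nhdsWithin (a, 0) {p | 0 ≤ p.1 ∧ 0 ≤ p.2}) (nhds a) := by
      have : Tendsto (fun p : ℝ × ℝ => p.1 - p.2) (nhds (a, 0)) (nhds (a - 0)) :=
        (continuous_fst.sub continuous_snd).tendsto (a, (0 : ℝ))
      rw [sub_zero] at this
      exact this.mono_left nhdsWithin_le_nhds
    have h3 : mulTerm R a 0 = a := if_pos rfl
    rw [ContinuousWithinAt, h3]
    refine tendsto_of_tendsto_of_tendsto_of_le_of_le' h2 h1 ?_ ?_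
    · filter_upwards [self_mem_nhdsWithin] with p hp using sub_le_mulTerm R hp.1 hp.2
    · filter_upwards [self_mem_nhdsWithin] with p hp using mulTerm_le R hp.1 hp.2
  · have h1 : ContinuousWithinAt (fun p : ℝ × ℝ => p.2 * (omega R (p.1 / p.2) - 2))
        {p | 0 ≤ p.1 ∧ 0 ≤ p.2} (a, b) := by
      refine continuous_snd.continuousWithinAt.mul (ContinuousWithinAt.sub ?_
        continuousWithinAt_const)
      have h2 : ContinuousWithinAt (fun p : ℝ × ℝ => p.1 / p.2) {p | 0 ≤ p.1 ∧ 0 ≤ p.2} (a, b) :=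
        continuous_fst.continuousWithinAt.div continuous_snd.continuousWithinAt hb.ne'
      exact ContinuousWithinAt.comp (f := fun p : ℝ × ℝ => p.1 / p.2) (t := Set.Ici 0)
        (continuousOn_omega R (a / b) (div_nonneg ha hb.le)) h2
        fun p hp => div_nonneg hp.1 hp.2
    refine h1.congr_of_eventuallyEq ?_ (if_neg hb.ne')
    have : ∀ᶠ p : ℝ × ℝ in nhds (a, b), p.2 ≠ 0 :=
      continuous_snd.continuousAt.eventually_ne hb.ne'
    filter_upwards [nhdsWithin_le_nhds this] with p hp using if_neg hp

/-- The points `((σ₁, σ₂), (κ₁, κ₂))` at which the exponent is considered. -/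
def admissible : Set ((ℝ × ℝ) × (ℝ × ℝ)) :=
  {p | (0 ≤ p.1.1 ∧ p.1.1 ≤ p.2.1 ∧ p.2.1 ≤ 1) ∧ (0 ≤ p.1.2 ∧ p.1.2 ≤ p.2.2 ∧ p.2.2 ≤ 1)}

lemma isCompact_admissible : IsCompact admissible := by
  have hK : IsCompact (((Set.Icc (0 : ℝ) 1) ×ˢ (Set.Icc (0 : ℝ) 1)) ×ˢ
      ((Set.Icc (0 : ℝ) 1) ×ˢ (Set.Icc (0 : ℝ) 1))) :=
    (isCompact_Icc.prod isCompact_Icc).prod (isCompact_Icc.prod isCompact_Icc)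
  refine hK.of_isClosed_subset ?_ ?_
  · have key (f g : (ℝ × ℝ) × (ℝ × ℝ) → ℝ) (hf : Continuous f) (hg : Continuous g) :
        IsClosed {p | f p ≤ g p} := isClosed_le hf hg
    exact ((key (fun _ => 0) (fun p => p.1.1) (by fun_prop) (by fun_prop)).inter
        ((key (fun p => p.1.1) (fun p => p.2.1) (by fun_prop) (by fun_prop)).inter
          (key (fun p => p.2.1) (fun _ => 1) (by fun_prop) (by fun_prop)))).inter
      ((key (fun _ => 0) (fun p => p.1.2) (by fun_prop) (by fun_prop)).inter
        ((key (fun p => p.1.2) (fun p => p.2.2) (by fun_prop) (by fun_prop)).inter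
          (key (fun p => p.2.2) (fun _ => 1) (by fun_prop) (by fun_prop))))
  · rintro ⟨⟨a, b⟩, c, d⟩ ⟨⟨h1, h2, h3⟩, h4, h5, h6⟩
    exact ⟨⟨⟨h1, h2.trans h3⟩, h4, h5.trans h6⟩, ⟨h1.trans h2, h3⟩, h4.trans h5, h6⟩

lemma continuousOn_Gam :
    ContinuousOn (fun p : (ℝ × ℝ) × (ℝ × ℝ) => Gam R p.1.1 p.1.2 p.2.1 p.2.2) admissible := by
  have a1 : ContinuousOn (fun p : (ℝ × ℝ) × (ℝ × ℝ) => alpha p.1.1 p.2.1) admissible :=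
    continuousOn_alpha.comp (f := fun p : (ℝ × ℝ) × (ℝ × ℝ) => (p.1.1, p.2.1))
      (Continuous.continuousOn (by fun_prop)) fun p hp => ⟨hp.1.1, hp.1.2.1⟩
  have a2 : ContinuousOn (fun p : (ℝ × ℝ) × (ℝ × ℝ) => alpha p.1.2 p.2.2) admissible :=
    continuousOn_alpha.comp (f := fun p : (ℝ × ℝ) × (ℝ × ℝ) => (p.1.2, p.2.2))
      (Continuous.continuousOn (by fun_prop)) fun p hp => ⟨hp.2.1, hp.2.2.1⟩
  have b1 : ContinuousOn (fun p : (ℝ × ℝ) × (ℝ × ℝ) => beta p.1.1 p.2.1) admissible :=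
    continuousOn_beta.comp (f := fun p : (ℝ × ℝ) × (ℝ × ℝ) => (p.1.1, p.2.1))
      (Continuous.continuousOn (by fun_prop)) fun p hp => ⟨hp.1.1, hp.1.2.1⟩
  have b2 : ContinuousOn (fun p : (ℝ × ℝ) × (ℝ × ℝ) => beta p.1.2 p.2.2) admissible :=
    continuousOn_beta.comp (f := fun p : (ℝ × ℝ) × (ℝ × ℝ) => (p.1.2, p.2.2))
      (Continuous.continuousOn (by fun_prop)) fun p hp => ⟨hp.2.1, hp.2.2.1⟩
  have h1 : ContinuousOn (fun p : (ℝ × ℝ) × (ℝ × ℝ) => H p.1.1) admissible :=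
    (continuous_H.comp (by fun_prop)).continuousOn
  have h2 : ContinuousOn (fun p : (ℝ × ℝ) × (ℝ × ℝ) => H p.1.2) admissible :=
    (continuous_H.comp (by fun_prop)).continuousOn
  have m : ContinuousOn (fun p : (ℝ × ℝ) × (ℝ × ℝ) =>
      mulTerm R (alpha p.1.1 p.2.1 + alpha p.1.2 p.2.2)
        (min (beta p.1.1 p.2.1) (beta p.1.2 p.2.2))) admissible :=
    (continuousOn_mulTerm R).comp (f := fun p : (ℝ × ℝ) × (ℝ × ℝ) =>
      (alpha p.1.1 p.2.1 + alpha p.1.2 p.2.2, min (beta p.1.1 p.2.1) (beta p.1.2 p.2.2)))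
      ((a1.add a2).prodMk (b1.inf b2)) fun p hp =>
        ⟨add_nonneg (alpha_nonneg hp.1.1 hp.1.2.1) (alpha_nonneg hp.2.1 hp.2.2.1),
          le_min (beta_nonneg hp.1.1 hp.1.2.1 hp.1.2.2)
            (beta_nonneg hp.2.1 hp.2.2.1 hp.2.2.2)⟩
  exact (((((h1.add h2).sub a1).sub a2).add b1).add b2).add m

lemma continuous_gamSquare : Continuous ↿(gamSquare R) := by
  refine (continuousOn_Gam R).comp_continuous (f := fun p :
    (unitInterval × unitInterval) × (unitInterval × unitInterval) =>
      (((p.1.1 : ℝ), (p.1.2 : ℝ)), (between p.1.1 p.2.1, between p.1.2 p.2.2))) ?_ ?_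
  · unfold between
    fun_prop
  · intro p
    have h1 := between_mem p.1.1 p.2.1
    have h2 := between_mem p.1.2 p.2.2
    exact ⟨⟨p.1.1.2.1, h1.1, h1.2⟩, p.1.2.2.1, h2.1, h2.2⟩

lemma exists_isMaxMin : ∃ γ, IsMaxMin R γ := by
  have hc := continuous_gamSquare R
  have hmin (s) : IsMinOverKappa R s.1 s.2 (sInf (gamSquare R s '' Set.univ)) := by
    rw [isMinOverKappa_iff, ← Set.image_univ]
    refine (isCompact_univ.image ?_).isLeast_sInf (Set.univ_nonempty.image _)
    exact hc.comp (Continuous.prodMk_right s)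
  have hcont : Continuous fun s => sInf (gamSquare R s '' Set.univ) :=
    isCompact_univ.continuous_sInf hc
  obtain ⟨s, -, hs⟩ := isCompact_univ.exists_isMaxOn Set.univ_nonempty hcont.continuousOn
  refine ⟨_, fun σ₁ h1 σ₂ h2 => ⟨_, hmin (⟨σ₁, h1⟩, ⟨σ₂, h2⟩)⟩,
    ⟨s.1, s.1.2, s.2, s.2.2, hmin s⟩, ?_⟩
  rintro m ⟨σ₁, h1, σ₂, h2, hm⟩
  rw [hm.unique (hmin (⟨σ₁, h1⟩, ⟨σ₂, h2⟩))]
  exact hs (Set.mem_univ _)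

/-! ### A lower bound for the max-min -/

/-- On `[1/2, 1]` the concave `H` lies above its chord `2 * (1 - y)`. -/
lemma one_sub_le_H_max {y : ℝ} (h0 : 0 ≤ y) (h1 : y ≤ 1) : 1 - y ≤ H (max y (1 / 2)) := by
  rcases le_total y (1 / 2) with h | h
  · rw [max_eq_right h, H_half]
    linarith
  · rw [max_eq_left h]
    have hconc := Real.strictConcave_binEntropy.concaveOn.2
      (show (2⁻¹ : ℝ) ∈ Set.Icc 0 1 by norm_num) (show (1 : ℝ) ∈ Set.Icc 0 1 by norm_num)
      (show 0 ≤ 2 * (1 - y) by linarith) (show 0 ≤ 2 * y - 1 by linarith) (by ring)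
    simp only [smul_eq_mul, Real.binEntropy_two_inv, Real.binEntropy_one, mul_zero,
      add_zero] at hconc
    rw [show 2 * (1 - y) * 2⁻¹ + (2 * y - 1) * 1 = y by ring] at hconc
    rw [H, le_div_iff₀ log_two_pos]
    have := mul_nonneg (sub_nonneg.2 h1) log_two_pos.le
    linarith

lemma one_sub_le_beta {σ κ : ℝ} (h0 : 0 ≤ σ) (h1 : σ ≤ κ) : 1 - σ ≤ beta σ κ := by
  rcases (h0.trans h1).eq_or_lt with rfl | hκ
  · simp [beta, h0]
  have h := one_sub_le_H_max (div_mem_unit h0 h1).1 (div_mem_unit h0 h1).2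
  have h2 := mul_le_mul_of_nonneg_left h hκ.le
  rw [mul_sub, mul_div_cancel₀ _ hκ.ne', mul_one] at h2
  rw [beta]
  linarith

/-- As `mulTerm R a b ≥ a - b`, the `alpha` terms cancel and `β₁ + β₂ - min β₁ β₂ ≥ β₁ ≥ 1 - σ₁`
remains. -/
lemma le_Gam {σ₁ σ₂ κ₁ κ₂ : ℝ} (h : ((σ₁, σ₂), (κ₁, κ₂)) ∈ admissible) :
    H σ₁ + H σ₂ + 1 - σ₁ ≤ Gam R σ₁ σ₂ κ₁ κ₂ := by
  obtain ⟨⟨h1, h2, h3⟩, h4, h5, h6⟩ := h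
  have hb1 := beta_nonneg h1 h2 h3
  have hb2 := beta_nonneg h4 h5 h6
  have h := sub_le_mulTerm R (add_nonneg (alpha_nonneg h1 h2) (alpha_nonneg h4 h5))
    (le_min hb1 hb2)
  have := one_sub_le_beta h1 h2
  have := min_le_right (beta σ₁ κ₁) (beta σ₂ κ₂)
  rw [Gam]
  linarith

lemma H_third : H (1 / 3) = Real.log 3 / Real.log 2 - 2 / 3 := by
  have h : Real.binEntropy (1 / 3) = Real.log 3 - 2 / 3 * Real.log 2 := by
    rw [Real.binEntropy, show (1 - 1 / 3 : ℝ) = 2 / 3 by norm_num,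
      show ((2 : ℝ) / 3)⁻¹ = 3 / 2 by norm_num, show ((1 : ℝ) / 3)⁻¹ = 3 by norm_num,
      Real.log_div (by norm_num) (by norm_num)]
    ring
  rw [H, h, sub_div, mul_div_assoc, div_self log_two_pos.ne', mul_one]

/-- At `σ = (1/3, 1/2)` the bound `le_Gam` equals `(log₂ 3 - 2/3) + 1 + 1 - 1/3 = log₂ 6`. This is
what makes the computation of the tables `F_p` affordable. -/
lemma six_le_rpow_maxMin {γ : ℝ} (h : IsMaxMin R γ) : (6 : ℝ) ≤ 2 ^ γ := by
  have h1 : (1 / 3 : ℝ) ∈ Set.Icc (0 : ℝ) 1 := by norm_num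
  have h2 : (1 / 2 : ℝ) ∈ Set.Icc (0 : ℝ) 1 := by norm_num
  obtain ⟨m, hm⟩ := h.1 _ h1 _ h2
  have hmγ := h.2.2 ⟨_, h1, _, h2, hm⟩
  obtain ⟨κ₁, hκ₁, κ₂, hκ₂, rfl⟩ := hm.1
  have h3 := le_Gam R (σ₁ := 1 / 3) (σ₂ := 1 / 2) (κ₁ := κ₁) (κ₂ := κ₂)
    ⟨⟨h1.1, hκ₁.1, hκ₁.2⟩, h2.1, hκ₂.1, hκ₂.2⟩
  rw [H_third, H_half] at h3
  have h4 : Real.log 6 / Real.log 2 ≤ γ := by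
    rw [show (6 : ℝ) = 3 * 2 by norm_num, Real.log_mul (by norm_num) (by norm_num), add_div,
      div_self log_two_pos.ne']
    linarith
  calc (6 : ℝ) = 2 ^ (Real.log 6 / Real.log 2) := by
        rw [Real.rpow_def_of_pos two_pos, mul_div_cancel₀ _ log_two_pos.ne',
          Real.exp_log (by norm_num)]
    _ ≤ 2 ^ γ := Real.rpow_le_rpow_of_exponent_le one_le_two h4

/-! ### Rounding to integers -/

lemma div_mem_admissible {h s₁ s₂ k₁ k₂ : ℕ} (h1 : s₁ ≤ k₁) (h2 : s₂ ≤ k₂) (h3 : k₁ ≤ h)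
    (h4 : k₂ ≤ h) :
    (((s₁ / h : ℝ), (s₂ / h : ℝ)), ((k₁ / h : ℝ), (k₂ / h : ℝ))) ∈ admissible := by
  refine ⟨⟨by positivity, ?_, ?_⟩, by positivity, ?_, ?_⟩
  · simp only; gcongr
  · exact div_le_one_of_le₀ (by exact_mod_cast h3) (by positivity)
  · simp only; gcongr
  · exact div_le_one_of_le₀ (by exact_mod_cast h4) (by positivity)

/-- An optimal real `κ` is rounded up to `⌈κ * h⌉₊ / h`, which stays within `[s / h, 1]` and moves
by less than `1 / h`; uniform continuity of `Gam` does the rest. -/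
lemma exists_rounding {γ : ℝ} (hγ : IsMaxMin R γ) {ε : ℝ} (hε : 0 < ε) :
    ∃ h₀ : ℕ, ∀ h ≥ h₀, ∀ s₁ ≤ h, ∀ s₂ ≤ h, ∃ k₁ ∈ Finset.Icc s₁ h, ∃ k₂ ∈ Finset.Icc s₂ h,
      Gam R (s₁ / h) (s₂ / h) (k₁ / h) (k₂ / h) ≤ γ + ε := by
  have huc := isCompact_admissible.uniformContinuousOn_of_continuous (continuousOn_Gam R)
  rw [Metric.uniformContinuousOn_iff] at huc
  obtain ⟨δ, hδ, hu⟩ := huc ε hε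
  obtain ⟨h₀, hh₀⟩ := exists_nat_gt (1 / δ)
  refine ⟨h₀ + 1, fun h hh s₁ hs₁ s₂ hs₂ => ?_⟩
  have hpos : (0 : ℝ) < h := by exact_mod_cast (by omega : 0 < h)
  have hhδ : 1 / (h : ℝ) < δ := by
    have : (h₀ : ℝ) ≤ h := by exact_mod_cast (by omega : h₀ ≤ h)
    rw [div_lt_comm₀ hpos hδ]
    linarith
  have round : ∀ s ≤ h, ∀ κ ∈ Set.Icc ((s : ℝ) / h) 1, ∃ k ∈ Finset.Icc s h,
      |(k : ℝ) / h - κ| < δ := by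
    intro s _ κ hκ
    have hκ0 : 0 ≤ κ := le_trans (by positivity) hκ.1
    refine ⟨⌈κ * h⌉₊, Finset.mem_Icc.2 ⟨?_, ?_⟩, ?_⟩
    · have := ((div_le_iff₀ hpos).1 hκ.1).trans (Nat.le_ceil (κ * h))
      exact_mod_cast this
    · rw [Nat.ceil_le]
      exact mul_le_of_le_one_left hpos.le hκ.2
    · have h1 := Nat.le_ceil (κ * h)
      have h2 := Nat.ceil_lt_add_one (mul_nonneg hκ0 hpos.le)
      have h3 : (⌈κ * h⌉₊ : ℝ) / h - κ = (⌈κ * h⌉₊ - κ * h) / h := by field_simp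
      rw [h3, abs_of_nonneg (div_nonneg (sub_nonneg.2 h1) hpos.le)]
      refine lt_of_le_of_lt ?_ hhδ
      gcongr
      linarith
  have hs : ∀ s ≤ h, (s : ℝ) / h ∈ Set.Icc (0 : ℝ) 1 := fun s hs =>
    ⟨by positivity, div_le_one_of_le₀ (by exact_mod_cast hs) hpos.le⟩
  obtain ⟨m, hm⟩ := hγ.1 _ (hs s₁ hs₁) _ (hs s₂ hs₂)
  have hmγ := hγ.2.2 ⟨_, hs s₁ hs₁, _, hs s₂ hs₂, hm⟩
  obtain ⟨κ₁, hκ₁, κ₂, hκ₂, rfl⟩ := hm.1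
  obtain ⟨k₁, hk₁, hd₁⟩ := round s₁ hs₁ κ₁ hκ₁
  obtain ⟨k₂, hk₂, hd₂⟩ := round s₂ hs₂ κ₂ hκ₂
  refine ⟨k₁, hk₁, k₂, hk₂, ?_⟩
  rw [Finset.mem_Icc] at hk₁ hk₂
  have := hu _ (div_mem_admissible hk₁.1 hk₂.1 hk₁.2 hk₂.2) (((s₁ / h : ℝ), (s₂ / h : ℝ)), (κ₁, κ₂))
    ⟨⟨(hs s₁ hs₁).1, hκ₁.1, hκ₁.2⟩, (hs s₂ hs₂).1, hκ₂.1, hκ₂.2⟩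
    (by simpa [Prod.dist_eq, Real.dist_eq, hδ] using ⟨hd₁, hd₂⟩)
  rw [Real.dist_eq] at this
  linarith [(abs_lt.1 this).2]

lemma exists_rpow_Gam_le {γ : ℝ} (hγ : IsMaxMin R γ) {ε : ℝ} (hε : 0 < ε) :
    ∃ D > 0, ∀ h s₁ s₂ k₁ k₂ : ℕ, s₁ ≤ h → s₂ ≤ h → s₁ ≤ k₁ → k₁ ≤ h → s₂ ≤ k₂ → k₂ ≤ h →
      (∀ l₁ ∈ Finset.Icc s₁ h, ∀ l₂ ∈ Finset.Icc s₂ h,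
        Gam R (s₁ / h) (s₂ / h) (k₁ / h) (k₂ / h) ≤ Gam R (s₁ / h) (s₂ / h) (l₁ / h) (l₂ / h)) →
      (2 : ℝ) ^ (Gam R (s₁ / h) (s₂ / h) (k₁ / h) (k₂ / h) * h) ≤ D * 2 ^ ((γ + ε) * h) := by
  obtain ⟨h₀, hr⟩ := exists_rounding R hγ hε
  obtain ⟨M, hM⟩ := (isCompact_admissible.image_of_continuousOn (continuousOn_Gam R)).bddAbove
  -- Rounding works for `h ≥ h₀` only. For smaller `h` the bound `M` of `Gam` on the compact set
  -- gives a constant.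
  refine ⟨2 ^ ((|M| + |γ|) * h₀), by positivity,
    fun h s₁ s₂ k₁ k₂ hs₁ hs₂ hk₁ hk₁' hk₂ hk₂' hmin => ?_⟩
  rw [← Real.rpow_add two_pos]
  refine Real.rpow_le_rpow_of_exponent_le one_le_two ?_
  have hM0 := abs_nonneg M
  have hγ0 := abs_nonneg γ
  rcases le_or_gt h₀ h with hh | hh
  · obtain ⟨l₁, hl₁, l₂, hl₂, hle⟩ := hr h hh s₁ hs₁ s₂ hs₂
    have h1 := (hmin l₁ hl₁ l₂ hl₂).trans hle
    have h2 := mul_le_mul_of_nonneg_right h1 (Nat.cast_nonneg (α := ℝ) h)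
    have : 0 ≤ (|M| + |γ|) * h₀ := by positivity
    linarith
  · have h1 : Gam R (s₁ / h) (s₂ / h) (k₁ / h) (k₂ / h) ≤ M :=
      hM ⟨_, div_mem_admissible hk₁ hk₂ hk₁' hk₂', rfl⟩
    have hcast : (h : ℝ) ≤ h₀ := by exact_mod_cast hh.le
    have hh0 := Nat.cast_nonneg (α := ℝ) h
    have h3 : M - (γ + ε) ≤ |M| + |γ| := by
      linarith [le_abs_self M, neg_abs_le γ]
    calc Gam R (s₁ / h) (s₂ / h) (k₁ / h) (k₂ / h) * h ≤ M * h := by gcongr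
      _ = (M - (γ + ε)) * h + (γ + ε) * h := by ring
      _ ≤ (|M| + |γ|) * h₀ + (γ + ε) * h := by gcongr

end Exponent

/-! ### Binomial coefficients and entropy -/

section Binomial

open scoped Nat

/-- With `p = k / n`, the entropy bound is the reciprocal of the probability of one particular
outcome with `k` successes in `n` trials. This links `H` to the binomial distribution; the
convention `0 ^ 0 = 1` fits the ends. -/
lemma rpow_H {n k : ℕ} (hk : k ≤ n) :
    (2 : ℝ) ^ (H (k / n) * n) * (((k / n : ℝ)) ^ k * (1 - (k / n : ℝ)) ^ (n - k)) = 1 := by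
  rcases Nat.eq_zero_or_pos n with rfl | hn
  · obtain rfl : k = 0 := by omega
    simp
  have hn' : (0 : ℝ) < n := by exact_mod_cast hn
  set p : ℝ := k / n with hp
  have hpn : p * n = k := div_mul_cancel₀ _ hn'.ne'
  have key : ∀ (x : ℝ) (m : ℕ), 0 ≤ x → x * n = m → x ^ m = Real.exp (m * Real.log x) := by
    intro x m hx hxm
    rcases hx.eq_or_lt with rfl | hx
    · have : m = 0 := by
        rw [zero_mul] at hxm
        exact_mod_cast hxm.symm
      simp [this]
    · rw [mul_comm, Real.exp_mul, Real.exp_log hx, Real.rpow_natCast]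
  have h1 := key p k (by positivity) hpn
  have h2 := key (1 - p) (n - k)
    (sub_nonneg.2 (div_le_one_of_le₀ (by exact_mod_cast hk) hn'.le))
    (by rw [sub_mul, hpn, one_mul, Nat.cast_sub hk])
  rw [h1, h2, Real.rpow_def_of_pos two_pos, ← Real.exp_add, ← Real.exp_add, Real.exp_eq_one_iff,
    H, Real.binEntropy, Nat.cast_sub hk, Real.log_inv, Real.log_inv, ← hpn]
  have := log_two_pos.ne'
  field_simp
  ring

lemma sum_choose_mul_pow (n : ℕ) (p : ℝ) :
    ∑ m ∈ Finset.range (n + 1), p ^ m * (1 - p) ^ (n - m) * n.choose m = 1 := by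
  rw [← add_pow, add_sub_cancel, one_pow]

/-- A single term of the binomial distribution with `p = k / n` is at most `1`. -/
lemma choose_le_rpow {n k : ℕ} (hk : k ≤ n) : (n.choose k : ℝ) ≤ 2 ^ (H (k / n) * n) := by
  have hp0 : (0 : ℝ) ≤ k / n := by positivity
  have hp1 : (k / n : ℝ) ≤ 1 := div_le_one_of_le₀ (by exact_mod_cast hk) (by positivity)
  have h1 := rpow_H hk
  have h2 : (k / n : ℝ) ^ k * (1 - (k / n : ℝ)) ^ (n - k) * n.choose k ≤ 1 := by
    refine le_trans ?_ (sum_choose_mul_pow n (k / n)).le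
    refine Finset.single_le_sum (f := fun m => (k / n : ℝ) ^ m * (1 - (k / n : ℝ)) ^ (n - m) *
      n.choose m) (fun m _ => ?_) (Finset.mem_range.2 (by omega))
    have := sub_nonneg.2 hp1
    positivity
  calc (n.choose k : ℝ) = 2 ^ (H (k / n) * n) *
        ((k / n : ℝ) ^ k * (1 - (k / n : ℝ)) ^ (n - k) * n.choose k) := by
        rw [← mul_assoc, h1, one_mul]
    _ ≤ 2 ^ (H (k / n) * n) := mul_le_of_le_one_right (by positivity) h2

lemma factorial_mul_pow_le (k j : ℕ) : k ! * k ^ j ≤ j ! * k ^ k := by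
  rcases le_total k j with h | h
  · have := Nat.factorial_mul_pow_sub_le_factorial h
    calc k ! * k ^ j = k ! * k ^ (j - k) * k ^ k := by
          rw [mul_assoc, ← pow_add, Nat.sub_add_cancel h]
      _ ≤ j ! * k ^ k := by gcongr
  · have h1 := Nat.factorial_mul_descFactorial (Nat.sub_le k j)
    rw [Nat.sub_sub_self h] at h1
    calc k ! * k ^ j = j ! * k.descFactorial (k - j) * k ^ j := by rw [h1]
      _ ≤ j ! * k ^ (k - j) * k ^ j := by gcongr; exact Nat.descFactorial_le_pow _ _
      _ = j ! * k ^ k := by rw [mul_assoc, ← pow_add, Nat.sub_add_cancel h]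

/-- The value `k` is a mode of the binomial distribution with `p = k / n`, stated here with
denominators cleared. -/
lemma choose_mul_pow_le {n k j : ℕ} (hk : k ≤ n) (hj : j ≤ n) :
    n.choose j * (k ^ j * (n - k) ^ (n - j)) ≤ n.choose k * (k ^ k * (n - k) ^ (n - k)) := by
  have h1 := Nat.mul_le_mul (factorial_mul_pow_le k j) (factorial_mul_pow_le (n - k) (n - j))
  have e1 := Nat.choose_mul_factorial_mul_factorial hk
  have e2 := Nat.choose_mul_factorial_mul_factorial hj
  have hpos : 0 < k ! * (n - k)! * (j ! * (n - j)!) := by positivity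
  refine Nat.le_of_mul_le_mul_left ?_ hpos
  calc k ! * (n - k)! * (j ! * (n - j)!) * (n.choose j * (k ^ j * (n - k) ^ (n - j)))
      = n.choose j * j ! * (n - j)! * (k ! * k ^ j * ((n - k)! * (n - k) ^ (n - j))) := by ring
    _ ≤ n ! * (j ! * k ^ k * ((n - j)! * (n - k) ^ (n - k))) := by
        rw [e2]; gcongr
    _ = n.choose k * k ! * (n - k)! * (j ! * k ^ k * ((n - j)! * (n - k) ^ (n - k))) := by rw [e1]
    _ = _ := by ring

/-- The largest of the `n + 1` terms, which sum to `1`, is the one at the mode `k`. -/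
lemma rpow_le_choose {n k : ℕ} (hk : k ≤ n) :
    (2 : ℝ) ^ (H (k / n) * n) ≤ (n + 1) * n.choose k := by
  rcases Nat.eq_zero_or_pos n with rfl | hn
  · obtain rfl : k = 0 := by omega
    simp
  have hn' : (0 : ℝ) < n := by exact_mod_cast hn
  set p : ℝ := k / n with hp
  have hterm : ∀ j ≤ n, p ^ j * (1 - p) ^ (n - j) * n.choose j =
      (n.choose j * (k ^ j * (n - k) ^ (n - j)) : ℕ) / (n : ℝ) ^ n := by
    intro j hj
    have h1 : 1 - p = ((n - k : ℕ) : ℝ) / n := by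
      rw [Nat.cast_sub hk, sub_div, div_self hn'.ne']
    have h2 : (n : ℝ) ^ n = n ^ j * n ^ (n - j) := by rw [← pow_add, Nat.add_sub_cancel' hj]
    rw [h1, hp, div_pow, div_pow, h2]
    push_cast
    field_simp
  have hmax : ∀ j ∈ Finset.range (n + 1), p ^ j * (1 - p) ^ (n - j) * n.choose j ≤
      p ^ k * (1 - p) ^ (n - k) * n.choose k := by
    intro j hj
    have hj : j ≤ n := by simpa [Nat.lt_succ_iff] using hj
    rw [hterm j hj, hterm k hk]
    refine div_le_div_of_nonneg_right ?_ (by positivity)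
    exact_mod_cast choose_mul_pow_le hk hj
  have hsum := Finset.sum_le_card_nsmul _ _ _ hmax
  rw [sum_choose_mul_pow, Finset.card_range, nsmul_eq_mul] at hsum
  push_cast at hsum
  calc (2 : ℝ) ^ (H p * n) = 2 ^ (H p * n) * 1 := (mul_one _).symm
    _ ≤ 2 ^ (H p * n) * ((n + 1) * (p ^ k * (1 - p) ^ (n - k) * n.choose k)) := by gcongr
    _ = 2 ^ (H p * n) * (p ^ k * (1 - p) ^ (n - k)) * ((n + 1) * n.choose k) := by ring
    _ = (n + 1) * n.choose k := by rw [rpow_H hk, one_mul]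

/-- For `p = s / k ≥ 1/2` the weight `p ^ j * (1 - p) ^ (k - j)` does not decrease in `j`, so on the
tail `j ≥ s` it is at least its value at `s`, while the total probability is `1`. For `p ≤ 1/2` the
trivial bound `2 ^ k` is used. -/
lemma sum_choose_le_rpow {k s : ℕ} (hs : s ≤ k) :
    ((∑ j ∈ Finset.Icc s k, k.choose j : ℕ) : ℝ) ≤ 2 ^ (H (max (s / k) (1 / 2)) * k) := by
  have hsub : Finset.Icc s k ⊆ Finset.range (k + 1) := fun j hj => by
    rw [Finset.mem_Icc] at hj
    exact Finset.mem_range.2 (by omega)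
  rcases le_total (s / k : ℝ) (1 / 2) with h | h
  · rw [max_eq_right h, H_half, one_mul, Real.rpow_natCast]
    have := Finset.sum_le_sum_of_subset (f := k.choose) hsub
    rw [Nat.sum_range_choose] at this
    exact_mod_cast this
  · rw [max_eq_left h]
    set p : ℝ := s / k with hp
    have hp1 : p ≤ 1 := div_le_one_of_le₀ (by exact_mod_cast hs) (by positivity)
    have hq0 : 0 ≤ 1 - p := sub_nonneg.2 hp1
    have hp0 : 0 ≤ p := by linarith
    have h1 := rpow_H hs
    have h2 : p ^ s * (1 - p) ^ (k - s) * ((∑ j ∈ Finset.Icc s k, k.choose j : ℕ) : ℝ) ≤ 1 := by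
      push_cast
      rw [Finset.mul_sum]
      refine le_trans ?_ (sum_choose_mul_pow k p).le
      refine (Finset.sum_le_sum fun j hj => ?_).trans
        (Finset.sum_le_sum_of_subset_of_nonneg hsub fun j _ _ => by positivity)
      rw [Finset.mem_Icc] at hj
      refine mul_le_mul_of_nonneg_right ?_ (Nat.cast_nonneg _)
      have e1 : p ^ j = p ^ s * p ^ (j - s) := by rw [← pow_add, Nat.add_sub_cancel' hj.1]
      have e2 : (1 - p) ^ (k - s) = (1 - p) ^ (j - s) * (1 - p) ^ (k - j) := by
        rw [← pow_add]; congr 1; omega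
      rw [e1, e2, ← mul_assoc]
      gcongr
      linarith
    calc ((∑ j ∈ Finset.Icc s k, k.choose j : ℕ) : ℝ) = 2 ^ (H p * k) *
          (p ^ s * (1 - p) ^ (k - s) * ((∑ j ∈ Finset.Icc s k, k.choose j : ℕ) : ℝ)) := by
          rw [← mul_assoc, h1, one_mul]
      _ ≤ 2 ^ (H p * k) := mul_le_of_le_one_right (by positivity) h2

lemma alpha_mul {h k s : ℕ} (hk : k ≤ h) : alpha (s / h) (k / h) * h = H (s / k) * k := by
  rcases Nat.eq_zero_or_pos h with rfl | hh
  · obtain rfl : k = 0 := by omega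
    simp
  have hh' : (h : ℝ) ≠ 0 := by exact_mod_cast hh.ne'
  rw [alpha, div_div_div_cancel_right₀ hh']
  field_simp

lemma beta_mul {h k s : ℕ} (hk : k ≤ h) :
    beta (s / h) (k / h) * h = (h - k : ℕ) + H (max (s / k) (1 / 2)) * k := by
  rcases Nat.eq_zero_or_pos h with rfl | hh
  · obtain rfl : k = 0 := by omega
    simp
  have hh' : (h : ℝ) ≠ 0 := by exact_mod_cast hh.ne'
  rw [beta, div_div_div_cancel_right₀ hh', Nat.cast_sub hk]
  field_simp

end Binomial

/-! ### Greedy covering designs -/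

section Greedy

variable {U : Type u} [Fintype U] [DecidableEq U]

lemma mem_uncovered {s : ℕ} {prev : List (Finset U)} {K S : Finset U} :
    S ∈ uncovered s prev K ↔ (S ⊆ K ∧ S.card = s) ∧ ∀ K' ∈ prev, ¬ S ⊆ K' := by
  simp [uncovered, Finset.mem_powersetCard]

lemma uncovered_subset {s : ℕ} {prev : List (Finset U)} {K V : Finset U} (h : K ⊆ V) :
    uncovered s prev K ⊆ uncovered s prev V := fun S hS => by
  rw [mem_uncovered] at hS ⊢
  exact ⟨⟨hS.1.1.trans h, hS.1.2⟩, hS.2⟩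

lemma uncovered_snoc {s : ℕ} {prev : List (Finset U)} {K V : Finset U} (h : K ⊆ V) :
    (uncovered s (prev ++ [K]) V).card + (uncovered s prev K).card =
      (uncovered s prev V).card := by
  have : uncovered s (prev ++ [K]) V = uncovered s prev V \ uncovered s prev K := by
    ext S
    simp only [mem_uncovered, Finset.mem_sdiff, List.mem_append, List.mem_singleton]
    constructor
    · rintro ⟨h1, h2⟩
      exact ⟨⟨h1, fun K' hK' => h2 K' (Or.inl hK')⟩, fun h3 => h2 K (Or.inr rfl) h3.1.1⟩
    · rintro ⟨⟨h1, h2⟩, h3⟩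
      refine ⟨h1, ?_⟩
      rintro K' (hK' | rfl)
      · exact h2 K' hK'
      · exact fun h4 => h3 ⟨⟨h4, h1.2⟩, h2⟩
  rw [this]
  exact Finset.card_sdiff_add_card_eq_card (uncovered_subset h)

omit [Fintype U] in
/-- The number of `k`-subsets of `V` that contain a given `s`-subset. -/
lemma card_supersets {V S : Finset U} {k : ℕ} (hS : S ⊆ V) (hk : S.card ≤ k) :
    ((V.powersetCard k).filter fun K => S ⊆ K).card = (V.card - S.card).choose (k - S.card) := by
  rw [← Finset.card_sdiff_of_subset hS, ← Finset.card_powersetCard]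
  refine Finset.card_bij' (fun K _ => K \ S) (fun K _ => K ∪ S) ?_ ?_ ?_ ?_
  · intro K hK
    rw [Finset.mem_filter, Finset.mem_powersetCard] at hK
    rw [Finset.mem_powersetCard, Finset.card_sdiff_of_subset hK.2, hK.1.2]
    exact ⟨Finset.sdiff_subset_sdiff hK.1.1 le_rfl, rfl⟩
  · intro K hK
    rw [Finset.mem_powersetCard] at hK
    have hd : Disjoint K S := Finset.disjoint_of_subset_left hK.1 Finset.sdiff_disjoint
    rw [Finset.mem_filter, Finset.mem_powersetCard, Finset.card_union_of_disjoint hd, hK.2]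
    exact ⟨⟨Finset.union_subset (hK.1.trans Finset.sdiff_subset) hS, by omega⟩,
      Finset.subset_union_right⟩
  · intro K hK
    rw [Finset.mem_filter] at hK
    exact Finset.sdiff_union_of_subset hK.2
  · intro K hK
    rw [Finset.mem_powersetCard] at hK
    have hd : Disjoint K S := Finset.disjoint_of_subset_left hK.1 Finset.sdiff_disjoint
    rw [Finset.union_sdiff_right, hd.sdiff_eq_left]

/-- Double counting of the pairs `S ⊆ K`: each uncovered `S` lies in the same number of `k`-subsets.
-/
lemma sum_card_uncovered {V : Finset U} {s k : ℕ} (hsk : s ≤ k) (prev : List (Finset U)) :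
    ∑ K ∈ V.powersetCard k, (uncovered s prev K).card =
      (uncovered s prev V).card * (V.card - s).choose (k - s) := by
  have h1 := Finset.sum_card_bipartiteAbove_eq_sum_card_bipartiteBelow
    (s := uncovered s prev V) (t := V.powersetCard k) (fun S K => S ⊆ K)
  have h2 : ∀ K ∈ V.powersetCard k,
      (Finset.bipartiteBelow (fun S K : Finset U => S ⊆ K) (uncovered s prev V) K).card =
        (uncovered s prev K).card := by
    intro K hK
    rw [Finset.mem_powersetCard] at hK
    congr 1
    ext S
    simp only [Finset.bipartiteBelow, Finset.mem_filter, mem_uncovered]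
    constructor
    · rintro ⟨⟨⟨-, h3⟩, h4⟩, h5⟩
      exact ⟨⟨h5, h3⟩, h4⟩
    · rintro ⟨⟨h5, h3⟩, h4⟩
      exact ⟨⟨⟨h5.trans hK.1, h3⟩, h4⟩, h5⟩
  rw [← Finset.sum_congr rfl h2, ← h1, ← smul_eq_mul, ← Finset.sum_const]
  refine Finset.sum_congr rfl fun S hS => ?_
  rw [mem_uncovered] at hS
  rw [← hS.1.2]
  exact card_supersets hS.1.1 (hS.1.2 ▸ hsk)

/-- A best choice covers at least the average. -/
lemma card_uncovered_mul_le {V K : Finset U} {s k : ℕ} (hsk : s ≤ k) (hk : k ≤ V.card)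
    {prev : List (Finset U)}
    (hK : ∀ K' ∈ V.powersetCard k, (uncovered s prev K').card ≤ (uncovered s prev K).card) :
    (uncovered s prev V).card * k.choose s ≤ (uncovered s prev K).card * V.card.choose s := by
  have h1 := Finset.sum_le_card_nsmul _ _ _ hK
  rw [sum_card_uncovered hsk, Finset.card_powersetCard, smul_eq_mul] at h1
  -- `C(n,k) C(k,s) = C(n,s) C(n-s,k-s)` turns the average into the ratio of `C(k,s)` to `C(n,s)`.
  have h2 := Nat.choose_mul (n := V.card) hsk
  have hpos : 0 < (V.card - s).choose (k - s) := Nat.choose_pos (by omega)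
  refine Nat.le_of_mul_le_mul_right ?_ hpos
  calc (uncovered s prev V).card * k.choose s * (V.card - s).choose (k - s)
      = (uncovered s prev V).card * (V.card - s).choose (k - s) * k.choose s := by ring
    _ ≤ V.card.choose k * (uncovered s prev K).card * k.choose s := by gcongr
    _ = (uncovered s prev K).card * (V.card.choose k * k.choose s) := by ring
    _ = _ := by rw [h2]; ring

/-- Induction on a bound for the number of uncovered sets: as long as one is left, a best choice
covers at least the average, hence at least one. -/
lemma exists_greedy_aux {V : Finset U} {s k : ℕ} (hsk : s ≤ k) (hk : k ≤ V.card) (n : ℕ) :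
    ∀ prev : List (Finset U), (uncovered s prev V).card ≤ n →
      (∀ K ∈ prev, K ∈ V.powersetCard k) →
      (∀ (p r : List (Finset U)) (K : Finset U), prev = p ++ K :: r →
        0 < (uncovered s p K).card ∧
          ∀ K' ∈ V.powersetCard k, (uncovered s p K').card ≤ (uncovered s p K).card) →
      ∃ 𝒦, IsGreedyCoveringDesign V s k 𝒦 := by
  induction n with
  | zero =>
    intro prev hn hmem hgr
    refine ⟨prev, hmem, hgr, fun S hS => ?_⟩
    by_contra! hcov
    have : S ∈ uncovered s prev V := by
      rw [Finset.mem_powersetCard] at hS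
      exact mem_uncovered.2 ⟨hS, hcov⟩
    have := Finset.card_pos.2 ⟨S, this⟩
    omega
  | succ n ih =>
    intro prev hn hmem hgr
    by_cases h0 : (uncovered s prev V).card = 0
    · exact ih prev (by omega) hmem hgr
    obtain ⟨K, hK, hmax⟩ := Finset.exists_max_image (V.powersetCard k)
      (fun K => (uncovered s prev K).card) (Finset.powersetCard_nonempty.2 hk)
    have hpos : 0 < (uncovered s prev K).card := by
      have h1 := card_uncovered_mul_le hsk hk hmax
      have h2 : 0 < (uncovered s prev V).card * k.choose s :=
        Nat.mul_pos (Nat.pos_of_ne_zero h0) (Nat.choose_pos hsk)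
      exact Nat.pos_of_mul_pos_right (h2.trans_le h1)
    have hKV := (Finset.mem_powersetCard.1 hK).1
    refine ih (prev ++ [K]) ?_ ?_ ?_
    · have := uncovered_snoc (s := s) (prev := prev) hKV
      omega
    · intro K' hK'
      rcases List.mem_append.1 hK' with h | h
      · exact hmem K' h
      · rw [List.mem_singleton.1 h]; exact hK
    · intro p r K' hp
      rcases List.eq_nil_or_concat r with rfl | ⟨r', L, rfl⟩
      · obtain ⟨rfl, h2⟩ := List.append_inj' hp rfl
        obtain rfl : K = K' := by simpa using h2
        exact ⟨hpos, hmax⟩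
      · have h3 : prev ++ [K] = (p ++ K' :: r') ++ [L] := by simpa using hp
        exact hgr p r' K' (List.append_inj' h3 rfl).1

lemma exists_isGreedyCoveringDesign {V : Finset U} {s k : ℕ} (hsk : s ≤ k) (hk : k ≤ V.card) :
    ∃ 𝒦, IsGreedyCoveringDesign V s k 𝒦 :=
  exists_greedy_aux hsk hk _ [] le_rfl (by simp) (by simp)

/-- Every choice covers at least the fraction `C(k,s) / C(|V|,s)` of what is still uncovered, so the
remainder decays geometrically. -/
lemma IsGreedyCoveringDesign.card_uncovered_le {V : Finset U} {s k : ℕ} {𝒦 : List (Finset U)}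
    (h : IsGreedyCoveringDesign V s k 𝒦) (hsk : s ≤ k) (hk : k ≤ V.card) :
    ∀ prev rest, 𝒦 = prev ++ rest → ((uncovered s prev V).card : ℝ) ≤
      V.card.choose s * (1 - k.choose s / V.card.choose s : ℝ) ^ prev.length := by
  have hMpos : (0 : ℝ) < V.card.choose s := by exact_mod_cast Nat.choose_pos (hsk.trans hk)
  have hle : (k.choose s : ℝ) / V.card.choose s ≤ 1 :=
    div_le_one_of_le₀ (by exact_mod_cast Nat.choose_le_choose s hk) hMpos.le
  intro prev
  induction prev using List.reverseRecOn with
  | nil =>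
    intro rest _
    simp [uncovered, Finset.card_powersetCard]
  | append_singleton prev K ih =>
    intro rest hrest
    have h1 := ih (K :: rest) (by simpa using hrest)
    obtain ⟨-, hmax⟩ := h.greedy prev rest K (by simpa using hrest)
    have hKV : K ⊆ V := (Finset.mem_powersetCard.1 (h.mem K (by simp [hrest]))).1
    have h2 := uncovered_snoc (s := s) (prev := prev) hKV
    have h3 := card_uncovered_mul_le hsk hk hmax
    have h2' : ((uncovered s (prev ++ [K]) V).card : ℝ) + (uncovered s prev K).card =
      (uncovered s prev V).card := by exact_mod_cast h2
    have h3' : ((uncovered s prev V).card : ℝ) * (k.choose s / V.card.choose s) ≤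
        (uncovered s prev K).card := by
      rw [← mul_div_assoc, div_le_iff₀ hMpos]
      exact_mod_cast h3
    rw [List.length_append, List.length_singleton, pow_succ, ← mul_assoc]
    calc ((uncovered s (prev ++ [K]) V).card : ℝ)
        ≤ (uncovered s prev V).card * (1 - k.choose s / V.card.choose s) := by
          rw [mul_sub, mul_one]; linarith
      _ ≤ _ := by gcongr

/-- The greedy algorithm is optimal up to a logarithmic factor. -/
lemma IsGreedyCoveringDesign.length_mul_le {V : Finset U} {s k : ℕ} {𝒦 : List (Finset U)}
    (h : IsGreedyCoveringDesign V s k 𝒦) (hsk : s ≤ k) (hk : k ≤ V.card) :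
    (𝒦.length : ℝ) * k.choose s ≤ (V.card + 1) * V.card.choose s := by
  have hMpos : (0 : ℝ) < V.card.choose s := by exact_mod_cast Nat.choose_pos (hsk.trans hk)
  have hkM : (k.choose s : ℝ) ≤ V.card.choose s := by exact_mod_cast Nat.choose_le_choose s hk
  rcases List.eq_nil_or_concat 𝒦 with rfl | ⟨prev, K, rfl⟩
  · simp only [List.length_nil, Nat.cast_zero, zero_mul]
    positivity
  rw [List.concat_eq_append] at h ⊢
  have h1 := h.card_uncovered_le hsk hk prev [K] rfl
  obtain ⟨hpos, -⟩ := h.greedy prev [] K rfl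
  have hKV : K ⊆ V := (Finset.mem_powersetCard.1 (h.mem K (by simp))).1
  -- The last member still covers something new, so at least one set was uncovered before it. With
  -- `C(|V|,s) ≤ exp |V|` this bounds the number of its predecessors; the last member itself is the
  -- `+ 1`.
  have h2 : (1 : ℝ) ≤ (uncovered s prev V).card := by
    exact_mod_cast hpos.trans_le (Finset.card_le_card (uncovered_subset hKV))
  set p : ℝ := k.choose s / V.card.choose s with hp
  have hp1 : p ≤ 1 := div_le_one_of_le₀ hkM hMpos.le
  have h3 : (V.card.choose s : ℝ) ≤ Real.exp V.card := by
    calc (V.card.choose s : ℝ) ≤ 2 ^ V.card := by exact_mod_cast Nat.choose_le_two_pow _ _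
      _ ≤ Real.exp 1 ^ V.card := by
          gcongr
          linarith [Real.add_one_le_exp 1]
      _ = Real.exp V.card := by rw [← Real.exp_nat_mul, mul_one]
  have h4 : (1 - p) ^ prev.length ≤ Real.exp (-(p * prev.length)) := by
    calc (1 - p) ^ prev.length ≤ Real.exp (-p) ^ prev.length := by
          exact pow_le_pow_left₀ (by linarith) (Real.one_sub_le_exp_neg p) _
      _ = Real.exp (-(p * prev.length)) := by rw [← Real.exp_nat_mul]; congr 1; ring
  have h5 : (1 : ℝ) ≤ Real.exp (V.card - p * prev.length) := by
    rw [sub_eq_add_neg, Real.exp_add]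
    refine (h2.trans h1).trans ?_
    have : 0 ≤ 1 - p := by linarith
    gcongr
  have h6 : p * prev.length ≤ V.card := by
    have := Real.one_le_exp_iff.1 h5
    linarith
  have h7 : p * (prev.length + 1) ≤ V.card + 1 := by linarith
  rw [hp, div_mul_eq_mul_div, div_le_iff₀ hMpos] at h7
  rw [List.length_append, List.length_singleton]
  push_cast
  linarith

/-- One factor `h + 1` is the loss of the greedy algorithm, the other comes from bounding `C(k,s)`
below by entropy. -/
lemma IsGreedyCoveringDesign.length_le {V : Finset U} {h s k : ℕ} {𝒦 : List (Finset U)}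
    (hg : IsGreedyCoveringDesign V s k 𝒦) (hV : V.card = h) (hsk : s ≤ k) (hk : k ≤ h) :
    (𝒦.length : ℝ) ≤ (h + 1) ^ 2 * 2 ^ ((H (s / h) - alpha (s / h) (k / h)) * h) := by
  subst hV
  have h1 := hg.length_mul_le hsk hk
  have h2 := choose_le_rpow (hsk.trans hk)
  have h3 := rpow_le_choose hsk
  have hk' : (k : ℝ) ≤ V.card := by exact_mod_cast hk
  rw [sub_mul, alpha_mul hk, Real.rpow_sub two_pos, ← mul_div_assoc, le_div_iff₀ (by positivity)]
  calc (𝒦.length : ℝ) * 2 ^ (H (s / k) * k) ≤ 𝒦.length * ((k + 1) * k.choose s) := by gcongr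
    _ = (k + 1) * (𝒦.length * k.choose s) := by ring
    _ ≤ (V.card + 1) * ((V.card + 1) * 2 ^ (H (s / V.card) * V.card)) := by
        refine mul_le_mul (by gcongr) (h1.trans ?_) (by positivity) (by positivity)
        gcongr
    _ = _ := by ring

/-! ### The numbers of rows and columns -/

omit [Fintype U] in
-- A row `T` is determined by `T ∩ K`, which has at least `s` elements, and by the arbitrary part `T
-- \ K`.
lemma card_rows_le {V K : Finset U} {h s k : ℕ} (hV : V.card = h)
    (hK : K ∈ V.powersetCard k) (hsk : s ≤ k) :
    ((rows V s K).card : ℝ) ≤ 2 ^ (beta (s / h) (k / h) * h) := by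
  rw [Finset.mem_powersetCard] at hK
  obtain ⟨hKV, hKk⟩ := hK
  have hkh : k ≤ h := hV ▸ hKk ▸ Finset.card_le_card hKV
  have h1 : (rows V s K).card ≤ (∑ j ∈ Finset.Icc s k, k.choose j) * 2 ^ (h - k) := by
    have e : ((Finset.Icc s k).biUnion fun j => K.powersetCard j).card ≤
        ∑ j ∈ Finset.Icc s k, k.choose j := by
      refine Finset.card_biUnion_le.trans (le_of_eq (Finset.sum_congr rfl fun j _ => ?_))
      rw [Finset.card_powersetCard, hKk]
    rw [← hV, ← hKk, ← Finset.card_sdiff_of_subset hKV, ← Finset.card_powerset, hKk]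
    refine le_trans ?_ (Nat.mul_le_mul_right _ e)
    rw [← Finset.card_product]
    refine Finset.card_le_card_of_injOn (fun T => (T ∩ K, T \ K)) ?_ ?_
    · intro T hT
      simp only [rows, Finset.coe_filter, Finset.mem_powerset, Set.mem_ofPred_eq] at hT
      simp only [Finset.coe_product, Set.mem_prod, Finset.mem_coe, Finset.mem_biUnion,
        Finset.mem_Icc, Finset.mem_powersetCard, Finset.mem_powerset]
      exact ⟨⟨_, ⟨hT.2, hKk ▸ Finset.card_le_card Finset.inter_subset_right⟩,
        Finset.inter_subset_right, rfl⟩, Finset.sdiff_subset_sdiff hT.1 le_rfl⟩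
    · intro T _ T' _ hTT
      simp only [Prod.mk.injEq] at hTT
      rw [← Finset.sdiff_union_inter T K, ← Finset.sdiff_union_inter T' K, hTT.1, hTT.2]
  rw [beta_mul hkh, Real.rpow_add two_pos, Real.rpow_natCast, mul_comm]
  calc ((rows V s K).card : ℝ)
      ≤ ((∑ j ∈ Finset.Icc s k, k.choose j : ℕ) : ℝ) * 2 ^ (h - k) := by exact_mod_cast h1
    _ ≤ _ := by
        gcongr
        exact sum_choose_le_rpow hsk

omit [Fintype U] in
lemma card_columns_le {K₁ K₂ : Finset U} {h s₁ s₂ k₁ k₂ : ℕ} (h₁ : K₁.card = k₁)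
    (h₂ : K₂.card = k₂) (hs₁ : s₁ ≤ k₁) (hs₂ : s₂ ≤ k₂) (hk₁ : k₁ ≤ h) (hk₂ : k₂ ≤ h) :
    ((columns s₁ s₂ K₁ K₂).card : ℝ) ≤
      2 ^ ((alpha (s₁ / h) (k₁ / h) + alpha (s₂ / h) (k₂ / h)) * h) := by
  have e : (columns s₁ s₂ K₁ K₂).card ≤ k₁.choose s₁ * k₂.choose s₂ := by
    refine Finset.card_image_le.trans (le_of_eq ?_)
    rw [Finset.card_product, Finset.card_powersetCard, Finset.card_powersetCard, h₁, h₂]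
  rw [add_mul, alpha_mul hk₁, alpha_mul hk₂, Real.rpow_add two_pos]
  calc ((columns s₁ s₂ K₁ K₂).card : ℝ) ≤ k₁.choose s₁ * k₂.choose s₂ := by exact_mod_cast e
    _ ≤ _ := by
        gcongr
        · exact choose_le_rpow hs₁
        · exact choose_le_rpow hs₂

end Greedy

/-! ### Counting operations in loops -/

namespace Counted

lemma val_bind {α β : Type u} (x : Counted α) (g : α → Counted β) :
    (x >>= g).val = (g x.val).val := rfl

lemma cost_bind {α β : Type u} (x : Counted α) (g : α → Counted β) :
    (x >>= g).cost = x.cost + (g x.val).cost := rfl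

lemma foldlM_invariant {α : Type w} {σ : Type u} (f : σ → α → Counted σ) (P : σ → Prop)
    (l : List α) (h : ∀ st, ∀ a ∈ l, P st → P (f st a).val) (st : σ) (h0 : P st) :
    P (l.foldlM f st).val := by
  induction l generalizing st with
  | nil => exact h0
  | cons a l ih =>
    rw [List.foldlM_cons, val_bind]
    exact ih (fun st b hb => h st b (List.mem_cons_of_mem a hb)) _
      (h st a List.mem_cons_self h0)

/-- What some iteration establishes and no iteration destroys holds in the end. -/
lemma foldlM_establish {α : Type w} {σ : Type u} (f : σ → α → Counted σ) (P : σ → Prop)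
    (l : List α) (h : ∀ st, ∀ a ∈ l, P st → P (f st a).val) {a : α} (ha : a ∈ l)
    (h' : ∀ st, P (f st a).val) (st : σ) : P (l.foldlM f st).val := by
  induction l generalizing st with
  | nil => simp at ha
  | cons b l ih =>
    rw [List.foldlM_cons, val_bind]
    have hl : ∀ st, ∀ a ∈ l, P st → P (f st a).val :=
      fun st c hc => h st c (List.mem_cons_of_mem b hc)
    rcases List.mem_cons.1 ha with rfl | ha
    · exact foldlM_invariant f P l hl _ (h' st)
    · exact ih hl ha _

lemma cost_foldlM_le {α : Type w} {σ : Type u} (f : σ → α → Counted σ) (l : List α) {c : ℝ}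
    (h : ∀ st, ∀ a ∈ l, ((f st a).cost : ℝ) ≤ c) (st : σ) :
    ((l.foldlM f st).cost : ℝ) ≤ l.length * c := by
  induction l generalizing st with
  | nil =>
    rw [List.foldlM_nil]
    simp [pure]
  | cons a l ih =>
    rw [List.foldlM_cons, cost_bind, List.length_cons]
    have h1 := h st a List.mem_cons_self
    have h2 := ih (fun st b hb => h st b (List.mem_cons_of_mem a hb)) (f st a).val
    push_cast
    linarith

lemma foldlM_mul {α : Type w} {R : Type v} [CommRing R] (g : α → R) (l : List α) (a : R) :
    l.foldlM (fun acc i => Counted.mul acc (g i)) a = ⟨a * (l.map g).prod, l.length⟩ := by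
  induction l generalizing a with
  | nil => simp [pure]
  | cons b l ih =>
    have h : (b :: l).foldlM (fun acc i => Counted.mul acc (g i)) a =
        ⟨(l.foldlM (fun acc i => Counted.mul acc (g i)) (a * g b)).val,
          1 + (l.foldlM (fun acc i => Counted.mul acc (g i)) (a * g b)).cost⟩ := rfl
    rw [h, ih, List.map_cons, List.prod_cons, mul_assoc, List.length_cons, add_comm]

end Counted

/-! ### Correctness of the algorithm -/

section Analysis

variable {R : Type v} [CommRing R] {U : Type u} [Fintype U] [DecidableEq U]

lemma computeF_val (V : Finset U) (f : U → Finset U → R) (T S : Finset U) :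
    (computeF V f).val (T, S) = if T ⊆ V ∧ S ∩ V ⊆ T then ∏ i ∈ T, f i S else 0 := by
  simp only [computeF, Counted.forAll, Counted.foldlM_mul, one_mul, Finset.mem_filter,
    Finset.mem_product, Finset.mem_powerset, Finset.mem_univ, and_true, Finset.prod_map_toList]

/-- An element of `V` has three possible positions relative to `S ∩ V ⊆ T ⊆ V`, and an element
outside `V` has two. Each entry takes at most `|V|` multiplications. -/
lemma computeF_cost_le (V : Finset U) (f : U → Finset U → R) :
    (computeF V f).cost ≤ V.card * (3 ^ V.card * 2 ^ Vᶜ.card) := by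
  simp only [computeF, Counted.forAll, Counted.foldlM_mul, Finset.length_toList]
  set D := (V.powerset ×ˢ (Finset.univ : Finset (Finset U))).filter fun p => p.2 ∩ V ⊆ p.1
  have h1 : D.card ≤ 3 ^ V.card * 2 ^ Vᶜ.card := by
    have h2 : D ⊆ V.powerset.biUnion fun T => (T ∪ Vᶜ).powerset.image fun S => (T, S) := by
      rintro ⟨T, S⟩ hp
      simp only [D, Finset.mem_filter, Finset.mem_product, Finset.mem_powerset] at hp
      simp only [Finset.mem_biUnion, Finset.mem_image, Finset.mem_powerset, Prod.mk.injEq]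
      refine ⟨T, hp.1.1, S, fun i hi => ?_, rfl, rfl⟩
      by_cases hV : i ∈ V
      · exact Finset.mem_union_left _ (hp.2 (Finset.mem_inter.2 ⟨hi, hV⟩))
      · exact Finset.mem_union_right _ (Finset.mem_compl.2 hV)
    calc D.card ≤ ∑ T ∈ V.powerset, 2 ^ T.card * 2 ^ Vᶜ.card := by
          refine (Finset.card_le_card h2).trans (Finset.card_biUnion_le.trans
            (Finset.sum_le_sum fun T _ => Finset.card_image_le.trans ?_))
          rw [Finset.card_powerset, ← pow_add]
          exact Nat.pow_le_pow_right two_pos (Finset.card_union_le _ _)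
      _ = 3 ^ V.card * 2 ^ Vᶜ.card := by
          rw [← Finset.sum_mul]
          have := Finset.sum_pow_mul_eq_add_pow 2 1 V
          simp only [one_pow, mul_one] at this
          rw [this]
  calc ∑ p ∈ D, p.1.card ≤ ∑ _p ∈ D, V.card := by
        refine Finset.sum_le_sum fun p hp => Finset.card_le_card ?_
        simp only [D, Finset.mem_filter, Finset.mem_product, Finset.mem_powerset] at hp
        exact hp.1.1
    _ = V.card * D.card := by rw [Finset.sum_const, smul_eq_mul, mul_comm]
    _ ≤ _ := by gcongr

/-- The contribution of `S` to the transform at `T`. -/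
def contribution (f : U → Finset U → R) (S T : Finset U) : R :=
  if S ⊆ T then ∏ i ∈ T, f i S else 0

lemma computeF_mul_computeF {U₁ U₂ : Finset U} (hd : Disjoint U₁ U₂)
    (hu : U₁ ∪ U₂ = Finset.univ) (f : U → Finset U → R) (S T : Finset U) :
    (computeF U₁ f).val (T ∩ U₁, S) * (computeF U₂ f).val (T ∩ U₂, S) = contribution f S T := by
  rw [computeF_val, computeF_val, contribution]
  have hT : T ∩ U₁ ∪ T ∩ U₂ = T := by
    rw [← Finset.inter_union_distrib_left, hu, Finset.inter_univ]
  have hiff : S ⊆ T ↔ S ∩ U₁ ⊆ T ∩ U₁ ∧ S ∩ U₂ ⊆ T ∩ U₂ := by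
    constructor
    · exact fun h => ⟨Finset.inter_subset_inter_right h, Finset.inter_subset_inter_right h⟩
    · rintro ⟨h1, h2⟩
      have hS : S ∩ U₁ ∪ S ∩ U₂ = S := by
        rw [← Finset.inter_union_distrib_left, hu, Finset.inter_univ]
      rw [← hS, ← hT]
      exact Finset.union_subset_union h1 h2
  by_cases h1 : S ∩ U₁ ⊆ T ∩ U₁
  · by_cases h2 : S ∩ U₂ ⊆ T ∩ U₂
    · rw [if_pos ⟨Finset.inter_subset_right, h1⟩, if_pos ⟨Finset.inter_subset_right, h2⟩,
        if_pos (hiff.2 ⟨h1, h2⟩), ← Finset.prod_union, hT]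
      exact Finset.disjoint_of_subset_left Finset.inter_subset_right
        (Finset.disjoint_of_subset_right Finset.inter_subset_right hd)
    · rw [if_neg (fun h => h2 h.2 : ¬ (T ∩ U₂ ⊆ U₂ ∧ S ∩ U₂ ⊆ T ∩ U₂)), mul_zero,
        if_neg fun h => h2 (hiff.1 h).2]
  · rw [if_neg (fun h => h1 h.2 : ¬ (T ∩ U₁ ⊆ U₁ ∧ S ∩ U₁ ⊆ T ∩ U₁)), zero_mul,
      if_neg fun h => h1 (hiff.1 h).1]

omit [Fintype U] in
lemma mem_rows_of_mem_columns {V K T S : Finset U} {s : ℕ} (hKV : K ⊆ V)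
    (hS : S ⊆ K) (hs : S.card = s) (hST : S ⊆ T) : T ∩ V ∈ rows V s K := by
  rw [rows, Finset.mem_filter, Finset.mem_powerset]
  refine ⟨Finset.inter_subset_right, hs ▸ Finset.card_le_card ?_⟩
  exact Finset.subset_inter (Finset.subset_inter hST (hS.trans hKV)) hS

lemma val_innerStep {h : ℕ} {U₁ U₂ : Finset U} (hd : Disjoint U₁ U₂)
    (hu : U₁ ∪ U₂ = Finset.univ) (ch : Choices R h U₁ U₂) (f : U → Finset U → R) {s₁ s₂ : ℕ}
    (st : (Finset U → R) × Finset (Finset U)) {K₁ K₂ : Finset U} (hK₁ : K₁ ⊆ U₁) (hK₂ : K₂ ⊆ U₂)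
    (T : Finset U) :
    (innerStep ch (computeF U₁ f).val (computeF U₂ f).val s₁ s₂ st (K₁, K₂)).val.1 T =
      st.1 T + ∑ S ∈ columns s₁ s₂ K₁ K₂ \ st.2, contribution f S T := by
  simp only [innerStep, Counted.val_bind, pure, Counted.forAll, Finset.mem_filter,
    Finset.mem_univ, true_and, Counted.add, fastRMM, Counted.runSLP]
  split_ifs with hT
  · congr 1
    rw [extendByZero, dif_pos hT]
    have h1 := (ch.rmm_optimal (rows U₁ s₁ K₁) (columns s₁ s₂ K₁ K₂ \ st.2) (rows U₂ s₂ K₂)).1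
      (Matrix.of fun i k => (computeF U₁ f).val (i, k))
      (Matrix.of fun k j => (computeF U₂ f).val (j, k)) ⟨_, hT.1⟩ ⟨_, hT.2⟩
    rw [Matrix.mul_apply] at h1
    simp only [Matrix.of_apply, computeF_mul_computeF hd hu] at h1
    rw [Finset.sum_coe_sort (columns s₁ s₂ K₁ K₂ \ st.2) fun S => contribution f S T] at h1
    exact h1
  -- A set `T` outside the trimmed rows contains none of the columns, so nothing is missing there.
  · rw [Finset.sum_eq_zero, add_zero]
    intro S hS
    refine if_neg fun hST => hT ?_
    rw [Finset.mem_sdiff, columns, Finset.mem_image] at hS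
    obtain ⟨⟨⟨S₁, S₂⟩, hp, rfl⟩, -⟩ := hS
    rw [Finset.mem_product, Finset.mem_powersetCard, Finset.mem_powersetCard] at hp
    exact ⟨mem_rows_of_mem_columns hK₁ hp.1.1 hp.1.2 (Finset.union_subset_left hST),
      mem_rows_of_mem_columns hK₂ hp.2.1 hp.2.2 (Finset.union_subset_right hST)⟩

lemma val_innerStep_snd {h : ℕ} {U₁ U₂ : Finset U} (ch : Choices R h U₁ U₂)
    (F₁ F₂ : Finset U × Finset U → R) (s₁ s₂ : ℕ) (st : (Finset U → R) × Finset (Finset U))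
    (K : Finset U × Finset U) :
    (innerStep ch F₁ F₂ s₁ s₂ st K).val.2 = st.2 ∪ columns s₁ s₂ K.1 K.2 := rfl

/-- The table holds the contributions of the columns that are already covered. -/
def TableInvariant (f : U → Finset U → R) (st : (Finset U → R) × Finset (Finset U)) : Prop :=
  ∀ T, st.1 T = ∑ S ∈ st.2, contribution f S T

lemma mem_of_mem_design {h : ℕ} {U₁ U₂ : Finset U} (ch : Choices R h U₁ U₂) {s₁ s₂ : ℕ}
    (hs₁ : s₁ ≤ h) (hs₂ : s₂ ≤ h) {K : Finset U × Finset U}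
    (hK : K ∈ ch.design₁ s₁ (ch.k s₁ s₂).1 ×ˢ ch.design₂ s₂ (ch.k s₁ s₂).2) :
    K.1 ∈ U₁.powersetCard (ch.k s₁ s₂).1 ∧ K.2 ∈ U₂.powersetCard (ch.k s₁ s₂).2 := by
  obtain ⟨h1, h2⟩ := ch.k_mem s₁ hs₁ s₂ hs₂
  rw [Finset.mem_Icc] at h1 h2
  obtain ⟨K₁, K₂⟩ := K
  replace hK := List.pair_mem_product.1 hK
  exact ⟨(ch.design₁_greedy _ _ h1.1 h1.2).mem _ hK.1, (ch.design₂_greedy _ _ h2.1 h2.2).mem _ hK.2⟩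

lemma TableInvariant.outerStep {h : ℕ} {U₁ U₂ : Finset U} (hd : Disjoint U₁ U₂)
    (hu : U₁ ∪ U₂ = Finset.univ) (ch : Choices R h U₁ U₂) (f : U → Finset U → R) {s₁ s₂ : ℕ}
    (hs₁ : s₁ ≤ h) (hs₂ : s₂ ≤ h) {st : (Finset U → R) × Finset (Finset U)}
    (hst : TableInvariant f st) :
    TableInvariant f
      (outerStep ch (computeF U₁ f).val (computeF U₂ f).val st (s₁, s₂)).val := by
  refine Counted.foldlM_invariant _ (TableInvariant f) _ ?_ st hst
  rintro st ⟨K₁, K₂⟩ hK hst T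
  obtain ⟨h1, h2⟩ := mem_of_mem_design ch hs₁ hs₂ hK
  rw [val_innerStep hd hu ch f st (Finset.mem_powersetCard.1 h1).1
    (Finset.mem_powersetCard.1 h2).1, val_innerStep_snd, hst T, ← Finset.union_sdiff_self_eq_union,
    Finset.sum_union Finset.disjoint_sdiff]

lemma outerStep_mono {h : ℕ} {U₁ U₂ : Finset U} (ch : Choices R h U₁ U₂)
    (F₁ F₂ : Finset U × Finset U → R) (s : ℕ × ℕ) {st : (Finset U → R) × Finset (Finset U)}
    {S : Finset U} (hS : S ∈ st.2) : S ∈ (outerStep ch F₁ F₂ st s).val.2 := by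
  refine Counted.foldlM_invariant _ (fun st => S ∈ st.2) _ ?_ st hS
  intro st K _ hS
  rw [val_innerStep_snd]
  exact Finset.mem_union_left _ hS

lemma mem_outerStep {h : ℕ} {U₁ U₂ : Finset U} (hu : U₁ ∪ U₂ = Finset.univ)
    (h₁ : U₁.card = h) (h₂ : U₂.card = h) (ch : Choices R h U₁ U₂)
    (F₁ F₂ : Finset U × Finset U → R) (st : (Finset U → R) × Finset (Finset U)) (S : Finset U) :
    S ∈ (outerStep ch F₁ F₂ st ((S ∩ U₁).card, (S ∩ U₂).card)).val.2 := by
  have hs₁ : (S ∩ U₁).card ≤ h := h₁ ▸ Finset.card_le_card Finset.inter_subset_right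
  have hs₂ : (S ∩ U₂).card ≤ h := h₂ ▸ Finset.card_le_card Finset.inter_subset_right
  obtain ⟨hk₁, hk₂⟩ := ch.k_mem _ hs₁ _ hs₂
  rw [Finset.mem_Icc] at hk₁ hk₂
  obtain ⟨K₁, hK₁, hS₁⟩ := (ch.design₁_greedy _ _ hk₁.1 hk₁.2).covers (S ∩ U₁)
    (Finset.mem_powersetCard.2 ⟨Finset.inter_subset_right, rfl⟩)
  obtain ⟨K₂, hK₂, hS₂⟩ := (ch.design₂_greedy _ _ hk₂.1 hk₂.2).covers (S ∩ U₂)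
    (Finset.mem_powersetCard.2 ⟨Finset.inter_subset_right, rfl⟩)
  refine Counted.foldlM_establish _ (fun st => S ∈ st.2) _ ?_
    (List.pair_mem_product.2 ⟨hK₁, hK₂⟩) ?_ st
  · intro st K _ hS
    rw [val_innerStep_snd]
    exact Finset.mem_union_left _ hS
  · intro st
    rw [val_innerStep_snd, columns]
    refine Finset.mem_union_right _ (Finset.mem_image.2 ⟨(S ∩ U₁, S ∩ U₂), ?_, ?_⟩)
    · exact Finset.mem_product.2 ⟨Finset.mem_powersetCard.2 ⟨hS₁, rfl⟩,
        Finset.mem_powersetCard.2 ⟨hS₂, rfl⟩⟩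
    · rw [← Finset.inter_union_distrib_left, hu, Finset.inter_univ]

/-- The algorithm is correct. -/
lemma coverColumns_val {h : ℕ} {U₁ U₂ : Finset U} (hd : Disjoint U₁ U₂)
    (hu : U₁ ∪ U₂ = Finset.univ) (h₁ : U₁.card = h) (h₂ : U₂.card = h)
    (ch : Choices R h U₁ U₂) (f : U → Finset U → R) :
    (coverColumns ch f).val = multiSubsetTransform f := by
  have hinv := Counted.foldlM_invariant
    (outerStep ch (computeF U₁ f).val (computeF U₂ f).val) (TableInvariant f)
    (List.range (h + 1) ×ˢ List.range (h + 1))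
    (by
      rintro st ⟨s₁, s₂⟩ hs hst
      have hs := List.pair_mem_product.1 hs
      rw [List.mem_range, List.mem_range] at hs
      exact hst.outerStep hd hu ch f (by omega) (by omega))
    ((fun _ => 0), ∅) (fun T => by simp)
  have hcov : ∀ S, S ∈ ((List.range (h + 1) ×ˢ List.range (h + 1)).foldlM
      (outerStep ch (computeF U₁ f).val (computeF U₂ f).val) ((fun _ => 0), ∅)).val.2 := by
    intro S
    refine Counted.foldlM_establish _ (fun st => S ∈ st.2) _
      (fun st s _ hS => outerStep_mono ch _ _ s hS)
      (List.pair_mem_product.2 ⟨List.mem_range.2 ?_, List.mem_range.2 ?_⟩)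
      (fun st => mem_outerStep hu h₁ h₂ ch _ _ st S) _
    · exact Nat.lt_succ_of_le (h₁ ▸ Finset.card_le_card Finset.inter_subset_right)
    · exact Nat.lt_succ_of_le (h₂ ▸ Finset.card_le_card Finset.inter_subset_right)
  funext T
  refine (hinv T).trans ?_
  rw [Finset.eq_univ_iff_forall.2 hcov]
  simp only [contribution, multiSubsetTransform]
  rw [← Finset.sum_filter]
  refine Finset.sum_congr ?_ fun _ _ => rfl
  ext S
  simp

/-! ### The number of operations of the algorithm -/

lemma card_filter_rows_le {U₁ U₂ : Finset U} (hu : U₁ ∪ U₂ = Finset.univ)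
    (𝒯₁ 𝒯₂ : Finset (Finset U)) :
    (Finset.univ.filter fun T : Finset U => T ∩ U₁ ∈ 𝒯₁ ∧ T ∩ U₂ ∈ 𝒯₂).card ≤
      𝒯₁.card * 𝒯₂.card := by
  rw [← Finset.card_product]
  refine Finset.card_le_card_of_injOn (fun T => (T ∩ U₁, T ∩ U₂)) ?_ ?_
  · intro T hT
    simpa using hT
  · intro T _ T' _ hTT
    simp only [Prod.mk.injEq] at hTT
    rw [← Finset.inter_univ T, ← Finset.inter_univ T', ← hu, Finset.inter_union_distrib_left,
      Finset.inter_union_distrib_left, hTT.1, hTT.2]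

/-- Dropping covered columns does not increase the cost of the product, and the additions to `G` are
at most one per pair of rows. -/
lemma cost_innerStep_le {h : ℕ} {U₁ U₂ : Finset U} (hu : U₁ ∪ U₂ = Finset.univ)
    (ch : Choices R h U₁ U₂) (F₁ F₂ : Finset U × Finset U → R) (s₁ s₂ : ℕ)
    (st : (Finset U → R) × Finset (Finset U)) (K₁ K₂ : Finset U) :
    (innerStep ch F₁ F₂ s₁ s₂ st (K₁, K₂)).cost ≤
      mulCost R (rows U₁ s₁ K₁).card (columns s₁ s₂ K₁ K₂).card (rows U₂ s₂ K₂).card +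
        (rows U₁ s₁ K₁).card * (rows U₂ s₂ K₂).card := by
  simp only [innerStep, Counted.cost_bind, pure, Counted.forAll, Counted.add, fastRMM,
    Counted.runSLP, add_zero, Finset.sum_const, smul_eq_mul, mul_one]
  refine add_le_add ?_ (card_filter_rows_le hu _ _)
  refine (ch.rmm_optimal _ _ _).size_le.trans ?_
  rw [Fintype.card_coe, Fintype.card_coe, Fintype.card_coe]
  exact mulCost_mono R le_rfl le_rfl (Finset.card_le_card Finset.sdiff_subset)

variable (R) [Nontrivial R]

/-- The cost of one pass of the outer loop. -/
lemma exists_cost_outerStep_le {ε : ℝ} (hε : 0 < ε) :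
    ∃ C > 0, ∀ (h : ℕ) (U : Type u) [Fintype U] [DecidableEq U] (U₁ U₂ : Finset U),
      U₁ ∪ U₂ = Finset.univ → U₁.card = h → U₂.card = h →
      ∀ (ch : Choices R h U₁ U₂) (F₁ F₂ : Finset U × Finset U → R) (s₁ s₂ : ℕ), s₁ ≤ h → s₂ ≤ h →
      ∀ st, ((outerStep ch F₁ F₂ st (s₁, s₂)).cost : ℝ) ≤ C * (h + 1) ^ 4 *
        2 ^ ((Gam R (s₁ / h) (s₂ / h) ((ch.k s₁ s₂).1 / h) ((ch.k s₁ s₂).2 / h) + ε) * h) := by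
  obtain ⟨C, hC, hrect⟩ := exists_mulCost_rect_le R hε
  refine ⟨C + 1, by positivity, ?_⟩
  intro h U _ _ U₁ U₂ hu h₁ h₂ ch F₁ F₂ s₁ s₂ hs₁ hs₂ st
  obtain ⟨hk₁, hk₂⟩ := ch.k_mem s₁ hs₁ s₂ hs₂
  rw [Finset.mem_Icc] at hk₁ hk₂
  have hadm := div_mem_admissible hk₁.1 hk₂.1 hk₁.2 hk₂.2
  set k₁ := (ch.k s₁ s₂).1
  set k₂ := (ch.k s₁ s₂).2
  obtain ⟨⟨p1, p2, p3⟩, q1, q2, q3⟩ := hadm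
  set a₁ := alpha (s₁ / h) (k₁ / h)
  set a₂ := alpha (s₂ / h) (k₂ / h)
  set b₁ := beta (s₁ / h) (k₁ / h)
  set b₂ := beta (s₂ / h) (k₂ / h)
  have ha₁ : 0 ≤ a₁ := alpha_nonneg p1 p2
  have ha₂ : 0 ≤ a₂ := alpha_nonneg q1 q2
  have ha₁' : a₁ ≤ 1 := (alpha_le (p1.trans p2)).trans p3
  have ha₂' : a₂ ≤ 1 := (alpha_le (q1.trans q2)).trans q3
  have hb₁ : 0 ≤ b₁ := beta_nonneg p1 p2 p3
  have hb₂ : 0 ≤ b₂ := beta_nonneg q1 q2 q3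
  have hb₁' : b₁ ≤ 1 := beta_le_one (p1.trans p2)
  have hb₂' : b₂ ≤ 1 := beta_le_one (q1.trans q2)
  set m := mulTerm R (a₁ + a₂) (min b₁ b₂)
  have hm : 0 ≤ m := mulTerm_nonneg R (add_nonneg ha₁ ha₂) (le_min hb₁ hb₂)
  have hh : (0 : ℝ) ≤ h := Nat.cast_nonneg h
  have hinner : ∀ st, ∀ K ∈ ch.design₁ s₁ k₁ ×ˢ ch.design₂ s₂ k₂,
      ((innerStep ch F₁ F₂ s₁ s₂ st K).cost : ℝ) ≤ (C + 1) * 2 ^ ((b₁ + b₂ + m + ε) * h) := by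
    rintro st ⟨K₁, K₂⟩ hK
    obtain ⟨hK₁, hK₂⟩ := mem_of_mem_design ch hs₁ hs₂ hK
    have hr₁ := card_rows_le h₁ hK₁ hk₁.1
    have hr₂ := card_rows_le h₂ hK₂ hk₂.1
    have hc := card_columns_le (Finset.mem_powersetCard.1 hK₁).2 (Finset.mem_powersetCard.1 hK₂).2
      hk₁.1 hk₂.1 hk₁.2 hk₂.2
    have h1 : ((innerStep ch F₁ F₂ s₁ s₂ st (K₁, K₂)).cost : ℝ) ≤
        mulCost R (rows U₁ s₁ K₁).card (columns s₁ s₂ K₁ K₂).card (rows U₂ s₂ K₂).card +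
          (rows U₁ s₁ K₁).card * (rows U₂ s₂ K₂).card := by
      exact_mod_cast cost_innerStep_le hu ch F₁ F₂ s₁ s₂ st K₁ K₂
    have h2 := hrect h (a₁ + a₂) b₁ b₂ hh (add_nonneg ha₁ ha₂) (by linarith) hb₁ hb₁' hb₂ hb₂'
      _ _ _ hc hr₁ hr₂
    -- The additions to `G` cost no more than the bound for the product, because `mulTerm` is
    -- nonnegative.
    have h3 : ((rows U₁ s₁ K₁).card : ℝ) * (rows U₂ s₂ K₂).card ≤
        2 ^ ((b₁ + b₂ + m + ε) * h) := by
      calc ((rows U₁ s₁ K₁).card : ℝ) * (rows U₂ s₂ K₂).card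
          ≤ 2 ^ (b₁ * h) * 2 ^ (b₂ * h) := by gcongr
        _ = 2 ^ ((b₁ + b₂) * h) := by rw [← Real.rpow_add two_pos, add_mul]
        _ ≤ _ := by
            refine Real.rpow_le_rpow_of_exponent_le one_le_two ?_
            refine mul_le_mul_of_nonneg_right ?_ hh
            linarith
    calc _ ≤ _ := h1
      _ ≤ C * 2 ^ ((b₁ + b₂ + m + ε) * h) + 2 ^ ((b₁ + b₂ + m + ε) * h) := add_le_add h2 h3
      _ = _ := by ring
  have hl₁ := (ch.design₁_greedy s₁ k₁ hk₁.1 hk₁.2).length_le h₁ hk₁.1 hk₁.2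
  have hl₂ := (ch.design₂_greedy s₂ k₂ hk₂.1 hk₂.2).length_le h₂ hk₂.1 hk₂.2
  have hout := Counted.cost_foldlM_le _ _ hinner st
  rw [List.length_product] at hout
  push_cast at hout
  refine hout.trans ?_
  calc ((ch.design₁ s₁ k₁).length : ℝ) * (ch.design₂ s₂ k₂).length *
        ((C + 1) * 2 ^ ((b₁ + b₂ + m + ε) * h))
      ≤ ((h + 1) ^ 2 * 2 ^ ((H (s₁ / h) - a₁) * h)) * ((h + 1) ^ 2 * 2 ^ ((H (s₂ / h) - a₂) * h)) *
        ((C + 1) * 2 ^ ((b₁ + b₂ + m + ε) * h)) := by gcongr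
    _ = (C + 1) * (h + 1) ^ 4 * 2 ^ ((H (s₁ / h) - a₁) * h + (H (s₂ / h) - a₂) * h +
          (b₁ + b₂ + m + ε) * h) := by
        rw [Real.rpow_add two_pos, Real.rpow_add two_pos]
        ring
    _ = _ := by
        congr 2
        rw [Gam]
        ring

lemma exists_pow_le_rpow (d : ℕ) {ε : ℝ} (hε : 0 < ε) :
    ∃ E > 0, ∀ h : ℕ, ((h : ℝ) + 1) ^ d ≤ E * 2 ^ (ε * h) := by
  have hr : 1 < (2 : ℝ) ^ ε := Real.one_lt_rpow one_lt_two hε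
  obtain ⟨E, hE, hb⟩ := bound_of_isBigO_nat_atTop
    (isLittleO_pow_const_const_pow_of_one_lt (R := ℝ) d hr).isBigO
  refine ⟨E * 2 ^ ε, by positivity, fun h => ?_⟩
  have h1 := hb (x := h + 1) (by positivity)
  rw [Real.norm_of_nonneg (by positivity), Real.norm_of_nonneg (by positivity)] at h1
  push_cast at h1
  rw [Real.rpow_mul zero_le_two, Real.rpow_natCast, mul_assoc, ← pow_succ']
  exact h1

/-- The number of operations of the algorithm. -/
lemma exists_cost_coverColumns_le {γ : ℝ} (hγ : IsMaxMin R γ) {ε : ℝ} (hε : 0 < ε) :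
    ∃ C : ℝ, ∀ (h : ℕ) (U : Type u) [Fintype U] [DecidableEq U] (U₁ U₂ : Finset U),
      Disjoint U₁ U₂ → U₁ ∪ U₂ = Finset.univ → U₁.card = h → U₂.card = h →
      ∀ (ch : Choices R h U₁ U₂) (f : U → Finset U → R),
        ((coverColumns ch f).cost : ℝ) ≤ C * 2 ^ ((γ + ε) * h) := by
  -- The three parts of `ε` pay for the matrix products, for rounding to integers, and for
  -- polynomial factors. The power `6` consists of `4` from the two designs and `2` from the pairs
  -- `(s₁, s₂)`.
  have hε3 : 0 < ε / 3 := by positivity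
  obtain ⟨C, hC, hout⟩ := exists_cost_outerStep_le.{u} R hε3
  obtain ⟨D, hD, hGam⟩ := exists_rpow_Gam_le R hγ hε3
  obtain ⟨E, hE, hpoly⟩ := exists_pow_le_rpow 6 hε3
  refine ⟨(2 + C * D) * E, ?_⟩
  intro h U _ _ U₁ U₂ hd hu h₁ h₂ ch f
  have hh : (0 : ℝ) ≤ h := Nat.cast_nonneg h
  have hc₁ : U₁ᶜ.card = h := by
    rw [← h₂]; congr 1
    exact (IsCompl.of_eq hd.eq_bot hu).compl_eq
  have hc₂ : U₂ᶜ.card = h := by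
    rw [← h₁]; congr 1
    exact (IsCompl.of_eq hd.eq_bot hu).symm.compl_eq
  have hF : ∀ V : Finset U, V.card = h → Vᶜ.card = h →
      ((computeF V f).cost : ℝ) ≤ (h + 1) ^ 6 * 2 ^ ((γ + ε / 3 + ε / 3) * h) := by
    intro V hV hV'
    have h1 : ((computeF V f).cost : ℝ) ≤ h * (3 ^ h * 2 ^ h) := by
      have := computeF_cost_le V f
      rw [hV, hV'] at this
      exact_mod_cast this
    calc ((computeF V f).cost : ℝ) ≤ h * (3 ^ h * 2 ^ h) := h1
      _ = h * 6 ^ h := by rw [← mul_pow]; norm_num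
      _ ≤ (h + 1) ^ 6 * (2 ^ γ) ^ h := by
          gcongr ?_ * ?_
          · calc (h : ℝ) ≤ h + 1 := by linarith
              _ ≤ (h + 1) ^ 6 := le_self_pow₀ (by linarith) (by norm_num)
          · exact pow_le_pow_left₀ (by norm_num) (six_le_rpow_maxMin R hγ) h
      _ = (h + 1) ^ 6 * 2 ^ (γ * h) := by rw [Real.rpow_mul zero_le_two, Real.rpow_natCast]
      _ ≤ _ := by
          gcongr ?_ * ?_
          refine Real.rpow_le_rpow_of_exponent_le one_le_two (mul_le_mul_of_nonneg_right ?_ hh)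
          linarith
  have hloop := Counted.cost_foldlM_le (outerStep ch (computeF U₁ f).val (computeF U₂ f).val)
    (List.range (h + 1) ×ˢ List.range (h + 1))
    (c := C * (h + 1) ^ 4 * (D * 2 ^ ((γ + ε / 3 + ε / 3) * h))) (by
      rintro st ⟨s₁, s₂⟩ hs
      have hs := List.pair_mem_product.1 hs
      rw [List.mem_range, List.mem_range] at hs
      have hs₁ : s₁ ≤ h := by omega
      have hs₂ : s₂ ≤ h := by omega
      refine (hout h U U₁ U₂ hu h₁ h₂ ch _ _ s₁ s₂ hs₁ hs₂ st).trans ?_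
      obtain ⟨hk₁, hk₂⟩ := ch.k_mem s₁ hs₁ s₂ hs₂
      rw [Finset.mem_Icc] at hk₁ hk₂
      have := hGam h s₁ s₂ _ _ hs₁ hs₂ hk₁.1 hk₁.2 hk₂.1 hk₂.2 (ch.k_min s₁ hs₁ s₂ hs₂)
      rw [add_mul _ _ (h : ℝ), Real.rpow_add two_pos, add_mul (γ + ε / 3),
        Real.rpow_add two_pos (_ * _), ← mul_assoc D]
      gcongr) ((fun _ => 0), ∅)
  rw [List.length_product, List.length_range] at hloop
  push_cast at hloop
  have hcost : (coverColumns ch f).cost = (computeF U₁ f).cost + ((computeF U₂ f).cost +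
      (((List.range (h + 1) ×ˢ List.range (h + 1)).foldlM
        (outerStep ch (computeF U₁ f).val (computeF U₂ f).val) ((fun _ => 0), ∅)).cost + 0)) := rfl
  rw [hcost]
  push_cast
  have hexp : (2 : ℝ) ^ ((γ + ε) * h) = 2 ^ (ε / 3 * h) * 2 ^ ((γ + ε / 3 + ε / 3) * h) := by
    rw [← Real.rpow_add two_pos]; congr 1; ring
  set Y : ℝ := 2 ^ ((γ + ε / 3 + ε / 3) * h)
  calc ((computeF U₁ f).cost : ℝ) + ((computeF U₂ f).cost +
        (((List.range (h + 1) ×ˢ List.range (h + 1)).foldlM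
        (outerStep ch (computeF U₁ f).val (computeF U₂ f).val) ((fun _ => 0), ∅)).cost + 0))
      ≤ (h + 1) ^ 6 * Y + ((h + 1) ^ 6 * Y +
        ((h + 1) * (h + 1) * (C * (h + 1) ^ 4 * (D * Y)) + 0)) := by
        gcongr
        · exact hF U₁ h₁ hc₁
        · exact hF U₂ h₂ hc₂
    _ = (2 + C * D) * (h + 1) ^ 6 * Y := by ring
    _ ≤ (2 + C * D) * (E * 2 ^ (ε / 3 * h)) * Y := by
        gcongr
        exact hpoly h
    _ = (2 + C * D) * E * 2 ^ ((γ + ε) * h) := by rw [hexp]; ring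

/-! ### Existence of the choices -/

omit [Nontrivial R] in
lemma nonempty_choices {h : ℕ} {U₁ U₂ : Finset U} (h₁ : U₁.card = h) (h₂ : U₂.card = h) :
    Nonempty (Choices R h U₁ U₂) := by
  classical
  have hk (s₁ s₂ : ℕ) : ∃ k : ℕ × ℕ, s₁ ≤ h → s₂ ≤ h →
      k ∈ Finset.Icc s₁ h ×ˢ Finset.Icc s₂ h ∧ ∀ l ∈ Finset.Icc s₁ h ×ˢ Finset.Icc s₂ h,
        Gam R (s₁ / h) (s₂ / h) (k.1 / h) (k.2 / h) ≤
          Gam R (s₁ / h) (s₂ / h) (l.1 / h) (l.2 / h) := by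
    by_cases hs : s₁ ≤ h ∧ s₂ ≤ h
    · obtain ⟨k, hk, hmin⟩ := Finset.exists_min_image (Finset.Icc s₁ h ×ˢ Finset.Icc s₂ h)
        (fun l => Gam R (s₁ / h) (s₂ / h) (l.1 / h) (l.2 / h))
        ⟨(h, h), by simp [hs]⟩
      exact ⟨k, fun _ _ => ⟨hk, hmin⟩⟩
    -- Sizes out of range are never used, so any value will do.
    · exact ⟨0, fun h1 h2 => absurd ⟨h1, h2⟩ hs⟩
  choose k hk using hk
  have hdes (V : Finset U) (hV : V.card = h) (s k : ℕ) : ∃ 𝒦, s ≤ k → k ≤ h →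
      IsGreedyCoveringDesign V s k 𝒦 := by
    by_cases hs : s ≤ k ∧ k ≤ h
    · obtain ⟨𝒦, h𝒦⟩ := exists_isGreedyCoveringDesign hs.1 (hV ▸ hs.2)
      exact ⟨𝒦, fun _ _ => h𝒦⟩
    · exact ⟨[], fun h1 h2 => absurd ⟨h1, h2⟩ hs⟩
  choose d₁ hd₁ using hdes U₁ h₁
  choose d₂ hd₂ using hdes U₂ h₂
  choose rmm hrmm using fun 𝒯₁ 𝒮 𝒯₂ : Finset (Finset U) =>
    exists_optimal (R := R) (α := 𝒯₁) (β := 𝒯₂) (γ := 𝒮)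
  exact ⟨{
    k := k
    design₁ := d₁
    design₂ := d₂
    rmm := rmm
    k_mem := fun s₁ hs₁ s₂ hs₂ => Finset.mem_product.1 (hk s₁ s₂ hs₁ hs₂).1
    k_min := fun s₁ hs₁ s₂ hs₂ k₁ hk₁ k₂ hk₂ =>
      (hk s₁ s₂ hs₁ hs₂).2 (k₁, k₂) (Finset.mem_product.2 ⟨hk₁, hk₂⟩)
    design₁_greedy := hd₁
    design₂_greedy := hd₂
    rmm_optimal := hrmm }⟩

end Analysis

end CoverColumns

theorem mainTheorem3 (R : Type v) [CommRing R] [Nontrivial R] :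
    ∃ γ : ℝ, CoverColumns.IsMaxMin R γ ∧
      ∀ ε : ℝ, 0 < ε → ∃ C : ℝ,
        ∀ (h : ℕ) (U : Type u) [Fintype U] [DecidableEq U] (U₁ U₂ : Finset U),
          Disjoint U₁ U₂ → U₁ ∪ U₂ = Finset.univ → U₁.card = h → U₂.card = h →
          Nonempty (CoverColumns.Choices R h U₁ U₂) ∧
          ∀ (ch : CoverColumns.Choices R h U₁ U₂) (f : U → Finset U → R),
            (CoverColumns.coverColumns ch f).val = CoverColumns.multiSubsetTransform f ∧
            ((CoverColumns.coverColumns ch f).cost : ℝ) ≤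
              C * (2 : ℝ) ^ ((γ + ε) * (Fintype.card U : ℝ) / 2) := by
  obtain ⟨γ, hγ⟩ := CoverColumns.exists_isMaxMin R
  refine ⟨γ, hγ, fun ε hε => ?_⟩
  obtain ⟨C, hC⟩ := CoverColumns.exists_cost_coverColumns_le.{u} R hγ hε
  refine ⟨C, fun h U _ _ U₁ U₂ hd hu h₁ h₂ => ⟨CoverColumns.nonempty_choices R h₁ h₂,
    fun ch f => ⟨CoverColumns.coverColumns_val hd hu h₁ h₂ ch f, ?_⟩⟩⟩
  have hcard : (Fintype.card U : ℝ) = 2 * h := by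
    rw [← Finset.card_univ, ← hu, Finset.card_union_of_disjoint hd, h₁, h₂]
    push_cast
    ring
  rw [hcard, show (γ + ε) * (2 * (h : ℝ)) / 2 = (γ + ε) * h by ring]
  exact hC h U U₁ U₂ hd hu h₁ h₂ ch f
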